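/- Let $0<\alpha<1$, $l,T>0$, $\bar Q_T=[0,l]\times[0,T]$. Let $C^{m,n}(\bar Q_T)$ denote the functions whose partial derivatives in $x$ up to order $m$ and in $t$ up to order $n$ exist and are continuous on $\bar Q_T$. Put $$\partial_{0t}^{1+\alpha}u(x,t)=\frac1{\Gamma(1-\alpha)}\int_0^t\frac{u_{\tau\tau}(x,\tau)}{(t-\tau)^{\alpha}}\,d\tau,\qquad D_{0t}^{\alpha-1}h(t)=\frac1{\Gamma(1-\alpha)}\int_0^t\frac{h(\tau)}{(t-\tau)^{\alpha}}\,d\tau,$$ $\|v\|_0^2=\int_0^l v(x)^2\,dx$, $\|v\|_{W_2^1(0,l)}^2=\|v\|_0^2+\|v_x\|_0^2$ and $\|\mu\|_{C[0,T]}=\max_{[0,T]}|\mu|$; for functions of $(x,t)$ the spatial norms are taken at fixed $t$. Let $u\in C^{2,2}(\bar Q_T)$ be a solution of the third boundary value problem $$\partial_{0t}^{1+\alpha}u=(k(x,t)u_x)_x-q(x,t)u+f(x,t),\quad 0<x<l,\ 0<t\le T,$$ $$k(0,t)u_x(0,t)=\beta_1(t)u(0,t)-\mu_1(t),\quad -k(l,t)u_x(l,t)=\beta_2(t)u(l,t)-\mu_2(t),\quad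 0\le t\le T,$$ $$u(x,0)=u_0(x),\quad u_t(x,0)=u_1(x),\quad 0\le x\le l,$$ where $k\in C^{1,1}(\bar Q_T)$, $q\in C^{0,1}(\bar Q_T)$, $f\in C(\bar Q_T)$, and $0<c_1\le k\le c_2$, $0<m_1\le q\le m_2$, $|k_t|,|q_t|\le c_3$ on $\bar Q_T$; and where $\beta_i,\mu_i\in C^1[0,T]$, $\beta_i(t)\ge\beta>0$, $|\beta_i'(t)|\le c_4$ for $t\in[0,T]$, $i=1,2$. Let $b$ be a number with $\beta_1(0),\beta_2(0)\le b$. Then for all $t\in[0,T]$ $$D_{0t}^{\alpha-1}\|u_t\|_0^2+\|u\|_{W_2^1(0,l)}^2\le M\int_0^t\bigl(\|f\|_0^2+\mu_1'(\tau)^2+\mu_2'(\tau)^2\bigr)\,d\tau+M\bigl(\|\mu_1\|_{C[0,T]}^2+\|\mu_2\|_{C[0,T]}^2+\|u_1\|_0^2+\|u_0\|_{W_2^1(0,l)}^2\bigr),$$ where the constant $M>0$ depends only on $\alpha,l,T,c_1,c_2,c_3,c_4,m_1,m_2,\beta$ and $b$. -/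

import Mathlib

open Set

noncomputable section

namespace FracWave

/-- The class `C^{m,n}` on the closed rectangle `[0,l] × [0,T]`: the pure partial derivatives in `x`
up to order `m` and in `t` up to order `n` exist (one-sided ones on the sides of the rectangle)
and are jointly continuous on the closed rectangle.  No mixed derivative is required to exist. -/
def IsClassC (m n : ℕ) (l T : ℝ) (g : ℝ → ℝ → ℝ) : Prop :=
  (∀ t ∈ Icc 0 T, ContDiffOn ℝ m (fun x => g x t) (Icc 0 l)) ∧
  (∀ x ∈ Icc 0 l, ContDiffOn ℝ n (fun t => g x t) (Icc 0 T)) ∧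
  (∀ j ≤ m, ContinuousOn
    (fun p : ℝ × ℝ => iteratedDerivWithin j (fun x => g x p.2) (Icc 0 l) p.1)
    (Icc 0 l ×ˢ Icc 0 T)) ∧
  (∀ j ≤ n, ContinuousOn
    (fun p : ℝ × ℝ => iteratedDerivWithin j (fun t => g p.1 t) (Icc 0 T) p.2)
    (Icc 0 l ×ˢ Icc 0 T))

/-- The partial derivative `g_x(x,t)`, one-sided at `x = 0` and `x = l`. -/
def pdx (l : ℝ) (g : ℝ → ℝ → ℝ) (x t : ℝ) : ℝ :=
  derivWithin (fun ξ => g ξ t) (Icc 0 l) x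

/-- The partial derivative `g_t(x,t)`, one-sided at `t = 0` and `t = T`. -/
def pdt (T : ℝ) (g : ℝ → ℝ → ℝ) (x t : ℝ) : ℝ :=
  derivWithin (fun τ => g x τ) (Icc 0 T) t

/-- The Caputo derivative of order `1 + α`, `0 < α < 1`, of a function `h` on `[0,T]`:
`(1/Γ(1-α)) ∫₀ᵗ h''(τ) (t-τ)^{-α} dτ`. -/
def caputo (T α : ℝ) (h : ℝ → ℝ) (t : ℝ) : ℝ :=
  1 / Real.Gamma (1 - α) *
    ∫ τ in (0 : ℝ)..t, iteratedDerivWithin 2 h (Icc 0 T) τ * (t - τ) ^ (-α)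

/-- The Riemann--Liouville integral of order `γ > 0`, i.e. `D_{0t}^{-γ} h`:
`(1/Γ(γ)) ∫₀ᵗ h(τ) (t-τ)^{γ-1} dτ`. -/
def rlIntegral (γ : ℝ) (h : ℝ → ℝ) (t : ℝ) : ℝ :=
  1 / Real.Gamma γ * ∫ τ in (0 : ℝ)..t, h τ * (t - τ) ^ (γ - 1)

/-- `‖v‖₀² = ∫₀ˡ v(x)² dx`. -/
def normSq (l : ℝ) (v : ℝ → ℝ) : ℝ := ∫ x in (0 : ℝ)..l, v x ^ 2

/-- `‖v‖²_{W₂¹(0,l)} = ‖v‖₀² + ‖v'‖₀²`. -/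
def sobolevNormSq (l : ℝ) (v : ℝ → ℝ) : ℝ :=
  normSq l v + normSq l (derivWithin v (Icc 0 l))

/-- `‖μ‖_{C[0,T]} = max_{0 ≤ t ≤ T} |μ(t)|`. -/
def supNorm (T : ℝ) (μ : ℝ → ℝ) : ℝ := sSup ((fun t => |μ t|) '' Icc 0 T)

/-- `u` is a solution, of class `C^{2,2}` on the closed rectangle, of the third boundary value
problem for the fractional wave equation. -/
structure IsRobinSolution (α l T : ℝ) (k q f : ℝ → ℝ → ℝ) (β₁ β₂ μ₁ μ₂ u₀ u₁ : ℝ → ℝ)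
    (u : ℝ → ℝ → ℝ) : Prop where
  regular : IsClassC 2 2 l T u
  equation : ∀ x ∈ Ioo 0 l, ∀ t ∈ Ioc 0 T,
    caputo T α (fun τ => u x τ) t =
      pdx l (fun ξ τ => k ξ τ * pdx l u ξ τ) x t - q x t * u x t + f x t
  left_boundary : ∀ t ∈ Icc 0 T, k 0 t * pdx l u 0 t = β₁ t * u 0 t - μ₁ t
  right_boundary : ∀ t ∈ Icc 0 T, -(k l t * pdx l u l t) = β₂ t * u l t - μ₂ t
  initial : ∀ x ∈ Icc 0 l, u x 0 = u₀ x
  initial_velocity : ∀ x ∈ Icc 0 l, pdt T u x 0 = u₁ x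

end FracWave

end

noncomputable section

namespace FracWave

open MeasureTheory Filter Topology

/-! The estimate is an energy argument: the equation is tested with `u_t` and integrated over the
interval in `x` and over `(0,t)` in time.

The fractional term is controlled by the inequality `v ∂^α v ≥ ½ ∂^α (v²)` for the Caputo derivative
of order `α`, with `v = u_t` (`caputo_sq_le`). Integrated in time it bounds the work of this term
below by half of `D^{α-1} ‖u_t‖²`, up to a multiple of `‖u₁‖²` (`half_fractional_energy_le`,
`IsRobinSolution.kinetic_le`).

The spatial terms form the derivative of an energy containing `k u_x²`, `q u²` and the boundary
contributions `½ β_i u² - μ_i u`. The Robin conditions cancel every boundary term with `u_t`, so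
only derivatives of the coefficients and of `μ_i` survive
(`IsRobinSolution.hasDerivWithinAt_energy`). Since `u_xt` need not exist, the elastic part is
differentiated through difference quotients (`hasDerivWithinAt_elastic`).

The work of `f` is split by Young's inequality. Its `‖u_t‖²` part is absorbed by the fractional
term, because the kernel `(t-τ)^{-α}` is at least `T^{-α}` (`integral_le_mul_rlIntegral`). The
energy is coercive up to `μ_i²` (`le_robinEnergy`), and the remaining lower-order integral is
removed by Grönwall's inequality (`energy_gronwall`). -/

/-! ### Weakly singular kernels and positivity of the Caputo derivative. -/

lemma intervalIntegrable_mul_sub_rpow {g : ℝ → ℝ} {s r : ℝ} (hs : 0 ≤ s) (hr : -1 < r)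
    (hg : ContinuousOn g (Icc 0 s)) :
    IntervalIntegrable (fun τ => g τ * (s - τ) ^ r) volume 0 s := by
  have h1 : IntervalIntegrable (fun x : ℝ => x ^ r) volume 0 s :=
    intervalIntegral.intervalIntegrable_rpow' hr
  have h2 := (h1.comp_sub_left s).symm
  simp only [sub_zero, sub_self] at h2
  exact h2.continuousOn_mul (by rwa [uIcc_of_le hs])

/-- Exchanging the order on the triangle `0 < τ < s < t` leaves the elementary integral of `(s-τ)^r`
over `s`, finite because `r > -1`. Integrability of the iterated integral is recorded as well, since
inequalities between such integrands are later integrated in `s`. -/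
lemma triangle_fubini {g : ℝ → ℝ} {t r : ℝ} (ht : 0 ≤ t) (hr : -1 < r)
    (hg : ContinuousOn g (Icc 0 t)) :
    IntervalIntegrable (fun s => ∫ τ in (0 : ℝ)..s, g τ * (s - τ) ^ r) volume 0 t ∧
    ∫ s in (0 : ℝ)..t, ∫ τ in (0 : ℝ)..s, g τ * (s - τ) ^ r =
      ∫ τ in (0 : ℝ)..t, g τ * ((t - τ) ^ (r + 1) / (r + 1)) := by
  -- With `g` and the kernel both truncated to `(0,t]`, the integrand is that of a convolution of
  -- two `L¹` functions, hence integrable on the plane.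
  set F : ℝ → ℝ := (Ioc 0 t).indicator g with hF
  set K : ℝ → ℝ := (Ioc 0 t).indicator (fun σ => σ ^ r) with hK
  have hFi : Integrable F volume := by
    rw [hF, integrable_indicator_iff measurableSet_Ioc]
    exact (hg.integrableOn_Icc).mono_set Ioc_subset_Icc_self
  have hKi : Integrable K volume := by
    rw [hK, integrable_indicator_iff measurableSet_Ioc]
    exact (intervalIntegrable_iff_integrableOn_Ioc_of_le ht).1
      (intervalIntegral.intervalIntegrable_rpow' hr)
  have hH : Integrable (fun p : ℝ × ℝ => F p.2 * K (p.1 - p.2)) (volume.prod volume) :=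
    hFi.convolution_integrand (ContinuousLinearMap.mul ℝ ℝ) hKi
  have hH' : Integrable (fun p : ℝ × ℝ => F p.2 * K (p.1 - p.2))
      ((volume.restrict (Ioc 0 t)).prod volume) := by
    have := hH.restrict (s := Ioc 0 t ×ˢ univ)
    rwa [← Measure.prod_restrict, Measure.restrict_univ] at this
  have e1 : ∀ s ∈ Ioc 0 t, ∫ τ, F τ * K (s - τ) = ∫ τ in (0 : ℝ)..s, g τ * (s - τ) ^ r := by
    intro s hs
    rw [intervalIntegral.integral_of_le hs.1.le, integral_Ioc_eq_integral_Ioo,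
      ← integral_indicator measurableSet_Ioo]
    congr 1
    ext τ
    by_cases hτ : τ ∈ Ioo 0 s
    · have h1 : τ ∈ Ioc 0 t := ⟨hτ.1, hτ.2.le.trans hs.2⟩
      have h2 : s - τ ∈ Ioc 0 t := ⟨sub_pos.2 hτ.2, by linarith [hτ.1, hs.2]⟩
      simp [hF, hK, indicator_of_mem hτ, indicator_of_mem h1, indicator_of_mem h2]
    · rw [indicator_of_notMem hτ]
      by_cases h1 : τ ∈ Ioc 0 t
      · have h2 : s - τ ∉ Ioc 0 t := fun h => hτ ⟨h1.1, sub_pos.1 h.1⟩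
        simp [hK, indicator_of_notMem h2]
      · simp [hF, indicator_of_notMem h1]
  have e2 : ∀ τ ∈ Ioc 0 t, ∫ s in Ioc 0 t, F τ * K (s - τ) =
      g τ * ((t - τ) ^ (r + 1) / (r + 1)) := by
    intro τ hτ
    rw [integral_const_mul, hF, indicator_of_mem hτ]
    congr 1
    have h3 : ∫ s in Ioc 0 t, K (s - τ) = ∫ s in Ioc τ t, (s - τ) ^ r := by
      rw [← integral_indicator measurableSet_Ioc, ← integral_indicator measurableSet_Ioc]
      congr 1
      ext s
      by_cases hs : s ∈ Ioc τ t
      · have h1 : s ∈ Ioc 0 t := ⟨hτ.1.trans hs.1, hs.2⟩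
        have h2 : s - τ ∈ Ioc 0 t := ⟨sub_pos.2 hs.1, by linarith [hτ.1, hs.2]⟩
        simp [hK, indicator_of_mem hs, indicator_of_mem h1, indicator_of_mem h2]
      · rw [indicator_of_notMem hs]
        by_cases h1 : s ∈ Ioc 0 t
        · have h2 : s - τ ∉ Ioc 0 t := fun h => hs ⟨sub_pos.1 h.1, h1.2⟩
          simp [hK, indicator_of_mem h1, indicator_of_notMem h2]
        · simp [indicator_of_notMem h1]
    rw [h3, ← intervalIntegral.integral_of_le hτ.2,
      intervalIntegral.integral_comp_sub_right (fun x : ℝ => x ^ r), sub_self,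
      integral_rpow (Or.inl hr), Real.zero_rpow (by linarith), sub_zero]
  constructor
  · rw [intervalIntegrable_iff_integrableOn_Ioc_of_le ht]
    exact (hH'.integral_prod_left).congr
      ((ae_restrict_mem measurableSet_Ioc).mono fun s hs => e1 s hs)
  · rw [intervalIntegral.integral_of_le ht, intervalIntegral.integral_of_le ht,
      ← setIntegral_congr_fun measurableSet_Ioc e1, integral_integral_swap (by exact hH'),
      ← setIntegral_congr_fun measurableSet_Ioc e2, ← integral_indicator measurableSet_Ioc]
    congr 1
    ext τ
    by_cases hτ : τ ∈ Ioc 0 t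
    · rw [indicator_of_mem hτ]
    · simp [hF, indicator_of_notMem hτ]

/-- Integration of the Caputo derivative of a `C¹` function. -/
lemma integral_caputo_kernel {g g' : ℝ → ℝ} {t r : ℝ} (ht : 0 ≤ t) (hr : -1 < r)
    (hg : ContinuousOn g (Icc 0 t)) (hd : ∀ τ ∈ Ioo 0 t, HasDerivAt g (g' τ) τ)
    (hg' : ContinuousOn g' (Icc 0 t)) :
    ∫ s in (0 : ℝ)..t, ∫ τ in (0 : ℝ)..s, g' τ * (s - τ) ^ r =
      (∫ τ in (0 : ℝ)..t, g τ * (t - τ) ^ r) - g 0 * (t ^ (r + 1) / (r + 1)) := by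
  rw [(triangle_fubini ht hr hg').2]
  have hr0 : r + 1 ≠ 0 := by linarith
  have hcont : ContinuousOn (fun τ => (t - τ) ^ (r + 1) / (r + 1)) (Icc 0 t) := by
    apply ContinuousOn.div_const
    exact ContinuousOn.rpow_const (by fun_prop) fun _ _ => Or.inr (by linarith)
  have hd2 : ∀ τ ∈ Ioo 0 t, HasDerivAt (fun τ => (t - τ) ^ (r + 1) / (r + 1))
      (-(t - τ) ^ r) τ := by
    intro τ hτ
    have h1 : HasDerivAt (fun τ => t - τ) (-1) τ := by
      simpa using (hasDerivAt_id τ).const_sub t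
    have h2 := (h1.rpow_const (p := r + 1) (Or.inl (sub_pos.2 hτ.2).ne')).div_const (r + 1)
    refine h2.congr_deriv ?_
    rw [add_sub_cancel_right]
    field_simp
  have hi : IntervalIntegrable (fun τ => -(t - τ) ^ r) volume 0 t := by
    simpa using (intervalIntegrable_mul_sub_rpow (g := fun _ => -1) ht hr continuousOn_const)
  -- Integration by parts moves the derivative from `g` to the kernel; the boundary term at `τ = t`
  -- vanishes because `r + 1 > 0`.
  have key := intervalIntegral.integral_mul_deriv_eq_deriv_mul_of_hasDerivAt
    (u := g) (u' := g') (v := fun τ => (t - τ) ^ (r + 1) / (r + 1)) (v' := fun τ => -(t - τ) ^ r)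
    (by rwa [uIcc_of_le ht]) (by rwa [uIcc_of_le ht])
    (by simpa [min_eq_left ht, max_eq_right ht] using hd)
    (by simpa [min_eq_left ht, max_eq_right ht] using hd2)
    (by apply ContinuousOn.intervalIntegrable; rwa [uIcc_of_le ht]) hi
  simp only [mul_neg, intervalIntegral.integral_neg, sub_self, sub_zero,
    Real.zero_rpow hr0, zero_div, mul_zero] at key
  linarith

/-- The pointwise inequality `v ∂^α v ≥ ½ ∂^α v²` for the Caputo derivative. -/
lemma caputo_sq_le {v v' : ℝ → ℝ} {s α : ℝ} (hs : 0 < s) (hα : α ∈ Ioo (0 : ℝ) 1)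
    (hd : ∀ τ ∈ Icc 0 s, HasDerivWithinAt v (v' τ) (Icc 0 s) τ)
    (hv' : ContinuousOn v' (Icc 0 s)) :
    (∫ τ in (0 : ℝ)..s, (v τ * v' τ) * (s - τ) ^ (-α)) ≤
      v s * ∫ τ in (0 : ℝ)..s, v' τ * (s - τ) ^ (-α) := by
  have hv : ContinuousOn v (Icc 0 s) := fun τ hτ => (hd τ hτ).continuousWithinAt
  have hr : -1 < -α := by linarith [hα.2]
  have i1 := intervalIntegrable_mul_sub_rpow hs.le hr hv'
  have i2 : IntervalIntegrable (fun τ => (v τ * v' τ) * (s - τ) ^ (-α)) volume 0 s :=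
    intervalIntegrable_mul_sub_rpow hs.le hr (hv.mul hv')
  have i3 : IntervalIntegrable (fun τ => ((v s - v τ) * v' τ) * (s - τ) ^ (-α)) volume 0 s :=
    intervalIntegrable_mul_sub_rpow hs.le hr ((continuousOn_const.sub hv).mul hv')
  have hsplit : (∫ τ in (0 : ℝ)..s, ((v s - v τ) * v' τ) * (s - τ) ^ (-α)) =
      v s * (∫ τ in (0 : ℝ)..s, v' τ * (s - τ) ^ (-α)) -
      ∫ τ in (0 : ℝ)..s, (v τ * v' τ) * (s - τ) ^ (-α) := by
    rw [← intervalIntegral.integral_const_mul, ← intervalIntegral.integral_sub (i1.const_mul _) i2]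
    congr 1
    ext τ
    ring
  obtain ⟨C, hC⟩ := isCompact_Icc.exists_bound_of_continuousOn hv'
  have hC0 : 0 ≤ C := (norm_nonneg _).trans (hC 0 ⟨le_rfl, hs.le⟩)
  have hlip : ∀ τ ∈ Icc 0 s, |v s - v τ| ≤ C * (s - τ) := by
    intro τ hτ
    have := (convex_Icc (0 : ℝ) s).norm_image_sub_le_of_norm_hasDerivWithin_le hd hC hτ
      (right_mem_Icc.2 hs.le)
    simpa [Real.norm_eq_abs, abs_of_nonneg (sub_nonneg.2 hτ.2)] using this
  -- The difference of the two sides is the integral of `(v s - v τ) v' τ (s-τ)^(-α)`. This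
  -- integrand equals `Φ'` plus a nonnegative term from differentiating the kernel, so its integral
  -- is at least `Φ s - Φ 0 ≥ 0`.
  set Φ : ℝ → ℝ := fun τ => -(1 / 2) * ((v s - v τ) ^ 2 * (s - τ) ^ (-α)) with hΦ
  have hΦs : Φ s = 0 := by simp [hΦ]
  have hcont : ContinuousOn Φ (Icc 0 s) := by
    intro τ hτ
    rcases hτ.2.eq_or_lt with h | h
    · subst h
      rw [ContinuousWithinAt, hΦs]
      -- At the singular endpoint the squared Lipschitz bound beats the kernel, leaving the positive
      -- power `2 - α`.
      have hb : ∀ x ∈ Icc 0 τ, ‖Φ x‖ ≤ C ^ 2 * (τ - x) ^ (2 - α) := by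
        intro x hx
        rcases hx.2.eq_or_lt with h | h
        · subst h
          rw [hΦs, norm_zero]
          have := Real.rpow_nonneg (sub_nonneg.2 (le_refl x)) (2 - α)
          positivity
        · have hp : 0 < τ - x := sub_pos.2 h
          have h1 : (v τ - v x) ^ 2 ≤ (C * (τ - x)) ^ 2 := by
            rw [← sq_abs]
            exact pow_le_pow_left₀ (abs_nonneg _) (hlip x hx) 2
          have h2 : (τ - x) ^ (2 - α) = (τ - x) ^ 2 * (τ - x) ^ (-α) := by
            rw [sub_eq_add_neg 2 α, Real.rpow_add hp, Real.rpow_two]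
          have h3 := Real.rpow_nonneg hp.le (-α)
          rw [hΦ, Real.norm_eq_abs, abs_mul, abs_of_nonneg (a := (v τ - v x) ^ 2 * _)
            (by positivity), h2]
          have : (v τ - v x) ^ 2 * (τ - x) ^ (-α) ≤ (C * (τ - x)) ^ 2 * (τ - x) ^ (-α) :=
            mul_le_mul_of_nonneg_right h1 h3
          have h4 : 0 ≤ (v τ - v x) ^ 2 * (τ - x) ^ (-α) := by positivity
          rw [abs_neg, abs_of_pos (by norm_num : (0 : ℝ) < 1 / 2)]
          nlinarith
      refine squeeze_zero_norm' (eventually_nhdsWithin_of_forall hb) ?_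
      have hc : Continuous fun x : ℝ => C ^ 2 * (τ - x) ^ (2 - α) := by
        apply continuous_const.mul
        exact Continuous.rpow_const (by fun_prop) fun _ => Or.inr (by linarith [hα.2])
      have := (hc.tendsto τ).mono_left (nhdsWithin_le_nhds (s := Icc 0 τ))
      simpa [Real.zero_rpow (by linarith [hα.2] : (2 : ℝ) - α ≠ 0)] using this
    · have hne : s - τ ≠ 0 := (sub_pos.2 h).ne'
      have h1 : ContinuousWithinAt (fun x => (s - x) ^ (-α)) (Icc 0 s) τ := by
        apply ContinuousAt.continuousWithinAt
        exact ContinuousAt.rpow_const (by fun_prop) (Or.inl hne)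
      exact continuousWithinAt_const.mul
        (((continuousWithinAt_const.sub (hv τ hτ)).pow 2).mul h1)
  have hder : ∀ τ ∈ Ioo 0 s, HasDerivAt Φ
      ((v s - v τ) * v' τ * (s - τ) ^ (-α) -
        α / 2 * ((v s - v τ) ^ 2 * (s - τ) ^ (-α - 1))) τ := by
    intro τ hτ
    have h0 : HasDerivAt v (v' τ) τ :=
      (hd τ (Ioo_subset_Icc_self hτ)).hasDerivAt (Icc_mem_nhds hτ.1 hτ.2)
    have h1 : HasDerivAt (fun τ => s - τ) (-1) τ := by
      simpa using (hasDerivAt_id τ).const_sub s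
    have h2 := h1.rpow_const (p := -α) (Or.inl (sub_pos.2 hτ.2).ne')
    have h3 := (((h0.const_sub (v s)).pow 2).mul h2).const_mul (-(1 / 2))
    refine h3.congr_deriv ?_
    simp
    ring
  have := intervalIntegral.sub_le_integral_of_hasDeriv_right_of_le hs.le hcont
    (fun τ hτ => (hder τ hτ).hasDerivWithinAt)
    ((intervalIntegrable_iff_integrableOn_Icc_of_le hs.le).1 i3)
    (fun τ hτ => by
      have h1 := Real.rpow_nonneg (sub_pos.2 hτ.2).le (-α - 1)
      have h2 : 0 ≤ α / 2 * ((v s - v τ) ^ 2 * (s - τ) ^ (-α - 1)) :=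
        mul_nonneg (by linarith [hα.1]) (by positivity)
      linarith)
  have hΦ0 : Φ 0 ≤ 0 := by
    have := Real.rpow_nonneg (sub_nonneg.2 hs.le) (-α)
    have h4 : 0 ≤ (v s - v 0) ^ 2 * (s - 0) ^ (-α) := by positivity
    simp only [hΦ]
    linarith
  rw [hsplit, hΦs] at this
  linarith

/-- Positivity of the Caputo derivative against the function itself, integrated in time. -/
lemma half_fractional_energy_le {v v' W : ℝ → ℝ} {t α : ℝ} (ht : 0 ≤ t) (hα : α ∈ Ioo (0 : ℝ) 1)
    (hd : ∀ τ ∈ Icc 0 t, HasDerivWithinAt v (v' τ) (Icc 0 t) τ)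
    (hv' : ContinuousOn v' (Icc 0 t)) (hW : ContinuousOn W (Icc 0 t))
    (hWeq : ∀ s ∈ Ioc 0 t, W s = ∫ τ in (0 : ℝ)..s, v' τ * (s - τ) ^ (-α)) :
    1 / 2 * ((∫ τ in (0 : ℝ)..t, v τ ^ 2 * (t - τ) ^ (-α)) -
        v 0 ^ 2 * (t ^ (1 - α) / (1 - α))) ≤ ∫ s in (0 : ℝ)..t, v s * W s := by
  have hv : ContinuousOn v (Icc 0 t) := fun τ hτ => (hd τ hτ).continuousWithinAt
  have hr : -1 < -α := by linarith [hα.2]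
  have hsq : ∀ τ ∈ Ioo 0 t, HasDerivAt (fun τ => v τ ^ 2) (2 * (v τ * v' τ)) τ := by
    intro τ hτ
    have h0 : HasDerivAt v (v' τ) τ :=
      (hd τ (Ioo_subset_Icc_self hτ)).hasDerivAt (Icc_mem_nhds hτ.1 hτ.2)
    refine (h0.pow 2).congr_deriv ?_
    simp
    ring
  have hc : ContinuousOn (fun τ => 2 * (v τ * v' τ)) (Icc 0 t) :=
    continuousOn_const.mul (hv.mul hv')
  have key := integral_caputo_kernel (g := fun τ => v τ ^ 2) ht hr (hv.pow 2) hsq hc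
  have hint := (triangle_fubini ht hr hc).1
  rw [show -α + 1 = 1 - α by ring] at key
  rw [← key, ← intervalIntegral.integral_const_mul]
  -- `W` is a continuous representative of the Caputo integral, so `v * W` is integrable at once;
  -- the two need only agree for `s > 0`.
  refine intervalIntegral.integral_mono_on_of_le_Ioo ht (hint.const_mul _) ?_ ?_
  · apply ContinuousOn.intervalIntegrable
    rw [uIcc_of_le ht]
    exact hv.mul hW
  · intro s hs
    have hsub : Icc 0 s ⊆ Icc 0 t := Icc_subset_Icc_right hs.2.le
    have := caputo_sq_le hs.1 hα (fun τ hτ => (hd τ (hsub hτ)).mono hsub) (hv'.mono hsub)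
    rw [hWeq s ⟨hs.1, hs.2.le⟩]
    refine le_trans (le_of_eq ?_) this
    rw [← intervalIntegral.integral_const_mul]
    congr 1
    ext τ
    ring

/-! ### Grönwall's inequality and the trace inequality. -/

/-- Grönwall's inequality in integral form, for the integral of the function. -/
lemma integral_le_of_le_add_mul_integral {Y : ℝ → ℝ} {t a K : ℝ} (ht : 0 ≤ t)
    (hY : ContinuousOn Y (Icc 0 t))
    (h : ∀ s ∈ Icc 0 t, Y s ≤ a + K * ∫ τ in (0 : ℝ)..s, Y τ) :
    ∫ τ in (0 : ℝ)..t, Y τ ≤ gronwallBound 0 K a t := by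
  have hYi : IntegrableOn Y (uIcc 0 t) := by
    rw [uIcc_of_le ht]; exact hY.integrableOn_Icc
  have hd : ∀ s ∈ Ico 0 t, HasDerivWithinAt (fun s => ∫ τ in (0 : ℝ)..s, Y τ) (Y s) (Ici s) s := by
    intro s hs
    have hi : IntervalIntegrable Y volume 0 s := by
      apply ContinuousOn.intervalIntegrable
      rw [uIcc_of_le hs.1]
      exact hY.mono (Icc_subset_Icc_right hs.2.le)
    have hcw : ContinuousWithinAt Y (Ici s) s :=
      (hY s ⟨hs.1, hs.2.le⟩).mono_of_mem_nhdsWithin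
        (mem_of_superset (Icc_mem_nhdsGE hs.2) (Icc_subset_Icc_left hs.1))
    have hm : StronglyMeasurableAtFilter Y (𝓝[>] s) volume :=
      ⟨Icc 0 t, mem_of_superset (Icc_mem_nhdsGT hs.2) (Icc_subset_Icc_left hs.1),
        hY.aestronglyMeasurable measurableSet_Icc⟩
    exact intervalIntegral.integral_hasDerivWithinAt_right hi hm
      (hcw.mono Ioi_subset_Ici_self)
  have := le_gronwallBound_of_liminf_deriv_right_le (f := fun s => ∫ τ in (0 : ℝ)..s, Y τ)
    (f' := Y) (δ := 0) (K := K) (ε := a) (a := 0) (b := t)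
    (by
      have := intervalIntegral.continuousOn_primitive_interval hYi
      rwa [uIcc_of_le ht] at this)
    (fun s hs r hr => (hd s hs).liminf_right_slope_le hr)
    (by simp)
    (fun s hs => by linarith [h s ⟨hs.1, hs.2.le⟩])
    t ⟨ht, le_rfl⟩
  simpa using this

/-- Linearity in the forcing lets the data factor out, so that the final constant involves only `K`
and the time. -/
lemma gronwallBound_zero_eq_mul (K a t : ℝ) :
    gronwallBound 0 K a t = a * gronwallBound 0 K 1 t := by
  by_cases hK : K = 0
  · subst hK; simp [gronwallBound_K0]
  · simp [gronwallBound_of_K_ne_0 hK]; ring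

/-- The trace inequality in `W₂¹(0,l)`. -/
lemma sq_le_trace {w w' : ℝ → ℝ} {l y : ℝ} (hl : 0 < l) (hy : y ∈ Icc 0 l)
    (hw : ∀ x ∈ Icc 0 l, HasDerivWithinAt w (w' x) (Icc 0 l) x)
    (hw' : ContinuousOn w' (Icc 0 l)) :
    w y ^ 2 ≤ (1 / l + 1) * ((∫ x in (0 : ℝ)..l, w x ^ 2) + ∫ x in (0 : ℝ)..l, w' x ^ 2) := by
  have hwc : ContinuousOn w (Icc 0 l) := fun x hx => (hw x hx).continuousWithinAt
  have hi : ∀ {g : ℝ → ℝ}, ContinuousOn g (Icc 0 l) → IntervalIntegrable g volume 0 l := by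
    intro g hg
    apply ContinuousOn.intervalIntegrable
    rwa [uIcc_of_le hl.le]
  set N := ∫ x in (0 : ℝ)..l, w x ^ 2
  set D := ∫ x in (0 : ℝ)..l, w' x ^ 2
  have hN : IntervalIntegrable (fun x => w x ^ 2) volume 0 l := hi (hwc.pow 2)
  have hD : IntervalIntegrable (fun x => w' x ^ 2) volume 0 l := hi (hw'.pow 2)
  -- The increment of `w²` is the integral of `2 w w'`, which is at most that of `w² + w'²`.
  -- Averaging the resulting bound over `x` then gives the trace inequality.
  have hdiff : ∀ x ∈ Icc 0 l, w y ^ 2 ≤ w x ^ 2 + (N + D) := by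
    intro x hx
    have hsub : uIcc x y ⊆ Icc 0 l := (convex_Icc (0 : ℝ) l).ordConnected.uIcc_subset hx hy
    have hd : ∀ z ∈ Ioo (min x y) (max x y), HasDerivAt (fun z => w z ^ 2) (2 * (w z * w' z)) z := by
      intro z hz
      have hz' : z ∈ Icc 0 l := hsub ⟨hz.1.le, hz.2.le⟩
      have h0 : HasDerivAt w (w' z) z := (hw z hz').hasDerivAt
        (Icc_mem_nhds ((le_min hx.1 hy.1).trans_lt hz.1) (hz.2.trans_le (max_le hx.2 hy.2)))
      refine (h0.pow 2).congr_deriv ?_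
      simp
      ring
    have hc : ContinuousOn (fun z => 2 * (w z * w' z)) (Icc 0 l) :=
      continuousOn_const.mul (hwc.mul hw')
    have e := intervalIntegral.integral_eq_sub_of_hasDeriv_right (f := fun z => w z ^ 2)
      ((hwc.mono hsub).pow 2) (fun z hz => (hd z hz).hasDerivWithinAt)
      (hc.mono hsub).intervalIntegrable
    have b1 : |∫ z in x..y, 2 * (w z * w' z)| ≤ ∫ z in (0 : ℝ)..l, (w z ^ 2 + w' z ^ 2) := by
      have h1 : ContinuousOn (fun z => w z ^ 2 + w' z ^ 2) (Icc 0 l) := (hwc.pow 2).add (hw'.pow 2)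
      have h2 := intervalIntegral.norm_integral_le_integral_norm_uIoc
        (f := fun z => 2 * (w z * w' z)) (μ := volume) (a := x) (b := y)
      have hsub' : uIoc x y ⊆ Ioc 0 l := by
        intro z hz
        exact ⟨(le_min hx.1 hy.1).trans_lt hz.1, hz.2.trans (max_le hx.2 hy.2)⟩
      have hI : IntegrableOn (fun z => w z ^ 2 + w' z ^ 2) (Ioc 0 l) :=
        h1.integrableOn_Icc.mono_set Ioc_subset_Icc_self
      rw [intervalIntegral.integral_of_le hl.le]
      refine h2.trans ?_
      refine le_trans ?_ (setIntegral_mono_set hI (ae_of_all _ fun z => by positivity)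
        hsub'.eventuallyLE)
      refine setIntegral_mono_on ?_ (hI.mono_set hsub') measurableSet_uIoc ?_
      · exact (hc.integrableOn_Icc.mono_set (hsub'.trans Ioc_subset_Icc_self)).norm
      · intro z _
        rw [Real.norm_eq_abs, abs_le]
        constructor <;> nlinarith [sq_nonneg (w z - w' z), sq_nonneg (w z + w' z)]
    rw [intervalIntegral.integral_add hN hD] at b1
    have := (le_abs_self _).trans b1
    rw [e] at this
    linarith
  have hint := intervalIntegral.integral_mono_on hl.le (f := fun _ => w y ^ 2)
    (g := fun x => w x ^ 2 + (N + D)) (by simp) (hN.add (by simp)) hdiff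
  rw [intervalIntegral.integral_add hN (by simp)] at hint
  simp only [intervalIntegral.integral_const, sub_zero, smul_eq_mul] at hint
  have hD0 : 0 ≤ D := intervalIntegral.integral_nonneg hl.le fun x _ => sq_nonneg _
  have : w y ^ 2 ≤ (N + l * (N + D)) / l := by
    rw [le_div_iff₀ hl]
    linarith
  refine this.trans ?_
  rw [add_div, mul_div_cancel_left₀ _ hl.ne']
  have : 0 ≤ D / l := by positivity
  have e : (1 / l + 1) * (N + D) = N / l + D / l + (N + D) := by ring
  linarith

/-! ### Integration and differentiation under the integral on a rectangle. -/

/-- Joint continuity on the closed rectangle `[0,l] × [0,T]`. -/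
abbrev ContRect (l T : ℝ) (g : ℝ → ℝ → ℝ) : Prop :=
  ContinuousOn (fun p : ℝ × ℝ => g p.1 p.2) (Icc 0 l ×ˢ Icc 0 T)

/-- A function continuous on a rectangle is the restriction of a function continuous on the
plane. -/
lemma exists_continuous_extension {g : ℝ → ℝ → ℝ} {l T : ℝ} (hl : 0 ≤ l) (hT : 0 ≤ T)
    (hg : ContRect l T g) :
    ∃ G : ℝ → ℝ → ℝ, Continuous (fun p : ℝ × ℝ => G p.1 p.2) ∧
      ∀ x ∈ Icc 0 l, ∀ t ∈ Icc 0 T, G x t = g x t := by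
  -- The extension clamps each coordinate to its interval.
  refine ⟨fun x t => g (projIcc 0 l hl x) (projIcc 0 T hT t), ?_, ?_⟩
  · exact hg.comp_continuous
      (f := fun p : ℝ × ℝ => ((projIcc 0 l hl p.1 : ℝ), (projIcc 0 T hT p.2 : ℝ)))
      (by fun_prop) fun p => ⟨Subtype.coe_prop _, Subtype.coe_prop _⟩
  · intro x hx t ht
    simp only [projIcc_of_mem hl hx, projIcc_of_mem hT ht]

lemma continuousOn_integral_fst {g : ℝ → ℝ → ℝ} {l T : ℝ} (hl : 0 ≤ l) (hT : 0 ≤ T)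
    (hg : ContRect l T g) :
    ContinuousOn (fun t => ∫ x in (0 : ℝ)..l, g x t) (Icc 0 T) := by
  obtain ⟨G, hG, he⟩ := exists_continuous_extension hl hT hg
  have h1 : Continuous fun t => ∫ x in (0 : ℝ)..l, G x t := by
    apply intervalIntegral.continuous_parametric_intervalIntegral_of_continuous'
    exact hG.comp continuous_swap
  refine h1.continuousOn.congr fun t ht => ?_
  refine intervalIntegral.integral_congr fun x hx => ?_
  rw [uIcc_of_le hl] at hx
  exact (he x hx t ht).symm

/-- Fubini's theorem for a continuous function against an integrable weight in time. -/
lemma integral_swap_mul_weight {g : ℝ → ℝ → ℝ} {φ : ℝ → ℝ} {l T t : ℝ} (hl : 0 ≤ l)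
    (ht : t ∈ Icc 0 T)
    (hg : ContRect l T g)
    (hφ : IntervalIntegrable φ volume 0 t) :
    (IntervalIntegrable (fun x => ∫ τ in (0 : ℝ)..t, g x τ * φ τ) volume 0 l) ∧
    ∫ x in (0 : ℝ)..l, ∫ τ in (0 : ℝ)..t, g x τ * φ τ =
      ∫ τ in (0 : ℝ)..t, (∫ x in (0 : ℝ)..l, g x τ) * φ τ := by
  have hT : 0 ≤ T := ht.1.trans ht.2
  obtain ⟨G, hG, he⟩ := exists_continuous_extension hl hT hg
  obtain ⟨C, hC⟩ := (isCompact_Icc.prod isCompact_Icc).exists_bound_of_continuousOn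
    (s := Icc 0 l ×ˢ Icc 0 T) hG.continuousOn
  have hsub : Icc 0 t ⊆ Icc 0 T := Icc_subset_Icc_right ht.2
  have hφ' : Integrable φ (volume.restrict (Ioc 0 t)) :=
    (intervalIntegrable_iff_integrableOn_Ioc_of_le ht.1).1 hφ
  have h1 : Integrable (fun p : ℝ × ℝ => (1 : ℝ) * φ p.2)
      ((volume.restrict (Ioc 0 l)).prod (volume.restrict (Ioc 0 t))) :=
    (integrable_const (1 : ℝ)).mul_prod hφ'
  have h2 : Integrable (fun p : ℝ × ℝ => G p.1 p.2 * φ p.2)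
      ((volume.restrict (Ioc 0 l)).prod (volume.restrict (Ioc 0 t))) := by
    have := h1.bdd_mul (f := fun p : ℝ × ℝ => G p.1 p.2) (c := C) hG.aestronglyMeasurable (by
      rw [Measure.prod_restrict]
      refine (ae_restrict_mem (measurableSet_Ioc.prod measurableSet_Ioc)).mono fun p hp => ?_
      exact hC p ⟨Ioc_subset_Icc_self hp.1, hsub (Ioc_subset_Icc_self hp.2)⟩)
    simpa using this
  have e1 : ∀ x ∈ Icc 0 l, ∫ τ in (0 : ℝ)..t, g x τ * φ τ = ∫ τ in Ioc 0 t, G x τ * φ τ := by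
    intro x hx
    rw [intervalIntegral.integral_of_le ht.1]
    refine setIntegral_congr_fun measurableSet_Ioc fun τ hτ => ?_
    simp only [he x hx τ (hsub (Ioc_subset_Icc_self hτ))]
  have e2 : ∀ τ ∈ Icc 0 t, (∫ x in (0 : ℝ)..l, g x τ) * φ τ = ∫ x in Ioc 0 l, G x τ * φ τ := by
    intro τ hτ
    rw [intervalIntegral.integral_of_le hl, integral_mul_const]
    congr 1
    refine setIntegral_congr_fun measurableSet_Ioc fun x hx => ?_
    simp only [he x (Ioc_subset_Icc_self hx) τ (hsub hτ)]
  constructor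
  · rw [intervalIntegrable_iff_integrableOn_Ioc_of_le hl]
    exact h2.integral_prod_left.congr ((ae_restrict_mem measurableSet_Ioc).mono
      fun x hx => (e1 x (Ioc_subset_Icc_self hx)).symm)
  · rw [intervalIntegral.integral_of_le hl, intervalIntegral.integral_of_le ht.1,
      setIntegral_congr_fun measurableSet_Ioc fun x hx => e1 x (Ioc_subset_Icc_self hx),
      setIntegral_congr_fun measurableSet_Ioc fun τ hτ => e2 τ (Ioc_subset_Icc_self hτ)]
    exact integral_integral_swap (by exact h2)

lemma ContRect.left {l T : ℝ} {g : ℝ → ℝ → ℝ} (hg : ContRect l T g) {t : ℝ} (ht : t ∈ Icc 0 T) :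
    ContinuousOn (fun x => g x t) (Icc 0 l) :=
  ContinuousOn.comp (f := fun x : ℝ => (x, t)) hg (by fun_prop) fun _ hx => ⟨hx, ht⟩

lemma ContRect.right {l T : ℝ} {g : ℝ → ℝ → ℝ} (hg : ContRect l T g) {x : ℝ} (hx : x ∈ Icc 0 l) :
    ContinuousOn (fun t => g x t) (Icc 0 T) :=
  ContinuousOn.comp (f := fun t : ℝ => (x, t)) hg (by fun_prop) fun _ ht => ⟨hx, ht⟩

lemma ContRect.intervalIntegrable {l T : ℝ} {g : ℝ → ℝ → ℝ} (hg : ContRect l T g) (hl : 0 ≤ l)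
    {t : ℝ} (ht : t ∈ Icc 0 T) : IntervalIntegrable (fun x => g x t) volume 0 l := by
  apply ContinuousOn.intervalIntegrable
  rw [uIcc_of_le hl]
  exact hg.left ht

lemma ContRect.exists_bound {l T : ℝ} {g : ℝ → ℝ → ℝ} (hg : ContRect l T g) :
    ∃ C, ∀ x ∈ Icc 0 l, ∀ t ∈ Icc 0 T, |g x t| ≤ C := by
  obtain ⟨C, hC⟩ := (isCompact_Icc.prod isCompact_Icc).exists_bound_of_continuousOn hg
  exact ⟨C, fun x hx t ht => hC (x, t) ⟨hx, ht⟩⟩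

lemma continuousOn_slope_fst {l T : ℝ} {g : ℝ → ℝ → ℝ} (hg : ContRect l T g) {s t : ℝ}
    (hs : s ∈ Icc 0 T) (ht : t ∈ Icc 0 T) :
    ContinuousOn (fun x => slope (g x) t s) (Icc 0 l) := by
  simp only [slope_def_field]
  exact ((hg.left hs).sub (hg.left ht)).div_const _

/-- Passage to the limit in the integral of a continuous weight against a difference quotient. -/
lemma tendsto_integral_mul_slope {l T : ℝ} {a g g' : ℝ → ℝ → ℝ} (hl : 0 ≤ l)
    (ha : ContRect l T a) (hg : ContRect l T g) (hg' : ContRect l T g')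
    (hd : ∀ x ∈ Icc 0 l, ∀ t ∈ Icc 0 T, HasDerivWithinAt (g x) (g' x t) (Icc 0 T) t)
    {t : ℝ} (ht : t ∈ Icc 0 T) :
    Tendsto (fun s => ∫ x in (0 : ℝ)..l, a x s * slope (g x) t s) (𝓝[Icc 0 T \ {t}] t)
      (𝓝 (∫ x in (0 : ℝ)..l, a x t * g' x t)) := by
  obtain ⟨A, hA⟩ := ha.exists_bound
  obtain ⟨C, hC⟩ := hg'.exists_bound
  have hmem : ∀ᶠ s in 𝓝[Icc 0 T \ {t}] t, s ∈ Icc 0 T :=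
    eventually_nhdsWithin_of_forall fun s hs => hs.1
  have hne : ∀ᶠ s in 𝓝[Icc 0 T \ {t}] t, s ≠ t :=
    eventually_nhdsWithin_of_forall fun s hs => hs.2
  have hsub : uIoc 0 l ⊆ Icc 0 l := by rw [uIoc_of_le hl]; exact Ioc_subset_Icc_self
  -- The mean value inequality bounds every difference quotient by the bound `C` of `g'`, which
  -- provides the dominating constant.
  refine intervalIntegral.tendsto_integral_filter_of_dominated_convergence (fun _ => A * C) ?_ ?_
    (by simp) ?_
  · filter_upwards [hmem] with s hs
    exact (((ha.left hs).mul (continuousOn_slope_fst hg hs ht)).mono hsub).aestronglyMeasurable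
      measurableSet_uIoc
  · filter_upwards [hmem, hne] with s hs hst
    refine ae_of_all _ fun x hx => ?_
    rw [norm_mul]
    have hx' := hsub hx
    refine mul_le_mul (hA x hx' s hs) ?_ (norm_nonneg _) ((abs_nonneg _).trans (hA x hx' s hs))
    have := (convex_Icc (0 : ℝ) T).norm_image_sub_le_of_norm_hasDerivWithin_le
      (hd x hx') (hC x hx') ht hs
    rw [slope_def_field, norm_div]
    exact (div_le_iff₀ (norm_pos_iff.2 (sub_ne_zero.2 hst))).2 this
  · refine ae_of_all _ fun x hx => ?_
    have hx' := hsub hx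
    refine Tendsto.mul ?_ (hasDerivWithinAt_iff_tendsto_slope.1 (hd x hx' t ht))
    exact ((ha.right hx') t ht).mono_left (nhdsWithin_mono _ sdiff_subset)

lemma hasDerivWithinAt_integral {l T : ℝ} {g g' : ℝ → ℝ → ℝ} (hl : 0 ≤ l)
    (hg : ContRect l T g) (hg' : ContRect l T g')
    (hd : ∀ x ∈ Icc 0 l, ∀ t ∈ Icc 0 T, HasDerivWithinAt (g x) (g' x t) (Icc 0 T) t)
    {t : ℝ} (ht : t ∈ Icc 0 T) :
    HasDerivWithinAt (fun t => ∫ x in (0 : ℝ)..l, g x t) (∫ x in (0 : ℝ)..l, g' x t)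
      (Icc 0 T) t := by
  rw [hasDerivWithinAt_iff_tendsto_slope]
  have h := tendsto_integral_mul_slope (a := fun _ _ => 1) hl continuousOn_const hg hg' hd ht
  simp only [one_mul] at h
  refine h.congr' (eventually_nhdsWithin_of_forall fun s hs => ?_)
  simp only [slope_def_field]
  rw [intervalIntegral.integral_div,
    intervalIntegral.integral_sub (hg.intervalIntegrable hl hs.1) (hg.intervalIntegrable hl ht)]

/-- Time derivative of the elastic energy `∫ k u_x²`; no mixed derivative of `u` is needed. -/
lemma hasDerivWithinAt_elastic {l T : ℝ} {k kx kt u ux uxx ut : ℝ → ℝ → ℝ} (hl : 0 ≤ l)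
    (hk : ContRect l T k) (hkx : ContRect l T kx) (hkt : ContRect l T kt)
    (hu : ContRect l T u) (hux : ContRect l T ux) (huxx : ContRect l T uxx) (hut : ContRect l T ut)
    (dkx : ∀ t ∈ Icc 0 T, ∀ x ∈ Icc 0 l,
      HasDerivWithinAt (fun x => k x t) (kx x t) (Icc 0 l) x)
    (dkt : ∀ x ∈ Icc 0 l, ∀ t ∈ Icc 0 T, HasDerivWithinAt (k x) (kt x t) (Icc 0 T) t)
    (dux : ∀ t ∈ Icc 0 T, ∀ x ∈ Icc 0 l,
      HasDerivWithinAt (fun x => u x t) (ux x t) (Icc 0 l) x)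
    (duxx : ∀ t ∈ Icc 0 T, ∀ x ∈ Icc 0 l,
      HasDerivWithinAt (fun x => ux x t) (uxx x t) (Icc 0 l) x)
    (dut : ∀ x ∈ Icc 0 l, ∀ t ∈ Icc 0 T, HasDerivWithinAt (u x) (ut x t) (Icc 0 T) t)
    {t : ℝ} (ht : t ∈ Icc 0 T) :
    HasDerivWithinAt (fun t => ∫ x in (0 : ℝ)..l, k x t * ux x t ^ 2)
      ((∫ x in (0 : ℝ)..l, kt x t * ux x t ^ 2) +
        2 * (k l t * ux l t * ut l t - k 0 t * ux 0 t * ut 0 t) -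
        2 * ∫ x in (0 : ℝ)..l, (kx x t * ux x t + k x t * uxx x t) * ut x t)
      (Icc 0 T) t := by
  have h0 : (0 : ℝ) ∈ Icc 0 l := ⟨le_rfl, hl⟩
  have hll : l ∈ Icc 0 l := ⟨hl, le_rfl⟩
  -- With the coefficient frozen at time `t`, the increment of `k u_x²` is `u_x(s)² (k(s) - k(t))`
  -- plus `p (u_x(s) - u_x(t))`. Integrating the last product by parts in `x` replaces the increment
  -- of `u_x` by that of `u`, whose quotient converges to `u_t`; meanwhile `p` tends to `2 k u_x`.
  set p : ℝ → ℝ → ℝ := fun x s => k x t * (ux x s + ux x t) with hp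
  set p' : ℝ → ℝ → ℝ := fun x s => kx x t * (ux x s + ux x t) + k x t * (uxx x s + uxx x t)
    with hp'
  have freeze : ∀ {g : ℝ → ℝ → ℝ}, ContRect l T g → ContRect l T (fun x _ => g x t) := by
    intro g hg
    exact ContinuousOn.comp (f := fun q : ℝ × ℝ => q.1) (hg.left ht) (by fun_prop)
      fun q hq => hq.1
  have cp : ContRect l T p := (freeze hk).mul (hux.add (freeze hux))
  have cp' : ContRect l T p' :=
    ((freeze hkx).mul (hux.add (freeze hux))).add ((freeze hk).mul (huxx.add (freeze huxx)))
  rw [hasDerivWithinAt_iff_tendsto_slope]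
  have l1 := tendsto_integral_mul_slope (a := fun x s => ux x s ^ 2) hl (hux.pow 2) hk hkt dkt ht
  have l2 := tendsto_integral_mul_slope hl cp' hu hut dut ht
  have bd : ∀ x ∈ Icc 0 l, Tendsto (fun s => p x s * slope (u x) t s) (𝓝[Icc 0 T \ {t}] t)
      (𝓝 (p x t * ut x t)) := fun x hx =>
    (((cp.right hx) t ht).mono_left (nhdsWithin_mono _ sdiff_subset)).mul
      (hasDerivWithinAt_iff_tendsto_slope.1 (dut x hx t ht))
  have lim := (l1.add ((bd l hll).sub (bd 0 h0))).sub l2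
  have hval : (∫ x in (0 : ℝ)..l, ux x t ^ 2 * kt x t) +
        (p l t * ut l t - p 0 t * ut 0 t) - (∫ x in (0 : ℝ)..l, p' x t * ut x t) =
      (∫ x in (0 : ℝ)..l, kt x t * ux x t ^ 2) +
        2 * (k l t * ux l t * ut l t - k 0 t * ux 0 t * ut 0 t) -
        2 * ∫ x in (0 : ℝ)..l, (kx x t * ux x t + k x t * uxx x t) * ut x t := by
    rw [← intervalIntegral.integral_const_mul]
    congr 1
    · congr 1
      · congr 1; ext x; ring
      · simp only [hp]; ring
    · congr 1; ext x; simp only [hp']; ring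
  rw [hval] at lim
  refine lim.congr' (eventually_nhdsWithin_of_forall fun s hs => ?_)
  have hs' : s ∈ Icc 0 T := hs.1
  have hu01 : uIcc 0 l = Icc 0 l := uIcc_of_le hl
  have ibp := intervalIntegral.integral_mul_deriv_eq_deriv_mul_of_hasDerivWithinAt
    (a := 0) (b := l) (u := fun x => p x s) (u' := fun x => p' x s)
    (v := fun x => u x s - u x t) (v' := fun x => ux x s - ux x t)
    (by
      intro x hx
      rw [hu01] at hx ⊢
      exact (dkx t ht x hx).mul ((duxx s hs' x hx).add (duxx t ht x hx)))
    (by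
      intro x hx
      rw [hu01] at hx ⊢
      exact (dux s hs' x hx).sub (dux t ht x hx))
    (cp'.intervalIntegrable hl hs')
    ((hux.intervalIntegrable hl hs').sub (hux.intervalIntegrable hl ht))
  have ii : ∀ {g : ℝ → ℝ}, ContinuousOn g (Icc 0 l) → IntervalIntegrable g volume 0 l := by
    intro g hg
    apply ContinuousOn.intervalIntegrable
    rwa [hu01]
  have hks := hk.left hs'
  have hkt' := hk.left ht
  have huxs := hux.left hs'
  have huxt := hux.left ht
  have split : (∫ x in (0 : ℝ)..l, k x s * ux x s ^ 2) - (∫ x in (0 : ℝ)..l, k x t * ux x t ^ 2) =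
      (∫ x in (0 : ℝ)..l, ux x s ^ 2 * (k x s - k x t)) +
        ∫ x in (0 : ℝ)..l, p x s * (ux x s - ux x t) := by
    have i1 : IntervalIntegrable (fun x => k x s * ux x s ^ 2) volume 0 l :=
      ii (hks.mul (huxs.pow 2))
    have i2 : IntervalIntegrable (fun x => k x t * ux x t ^ 2) volume 0 l :=
      ii (hkt'.mul (huxt.pow 2))
    have i3 : IntervalIntegrable (fun x => ux x s ^ 2 * (k x s - k x t)) volume 0 l :=
      ii ((huxs.pow 2).mul (hks.sub hkt'))
    have i4 : IntervalIntegrable (fun x => p x s * (ux x s - ux x t)) volume 0 l :=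
      ii ((cp.left hs').mul (huxs.sub huxt))
    rw [← intervalIntegral.integral_sub i1 i2, ← intervalIntegral.integral_add i3 i4]
    congr 1
    ext x
    simp only [hp]
    ring
  simp only [slope_def_field, split, ibp, mul_div_assoc', intervalIntegral.integral_div]
  ring

/-! ### Partial derivatives of functions of class `C^{m,n}`. -/

lemma hasDerivWithinAt_iteratedDerivWithin {h : ℝ → ℝ} {a b : ℝ} {n j : ℕ} (hab : a < b)
    (hh : ContDiffOn ℝ n h (Icc a b)) (hj : j < n) {x : ℝ} (hx : x ∈ Icc a b) :
    HasDerivWithinAt (iteratedDerivWithin j h (Icc a b))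
      (iteratedDerivWithin (j + 1) h (Icc a b) x) (Icc a b) x := by
  rw [iteratedDerivWithin_succ]
  exact (hh.differentiableOn_iteratedDerivWithin (by exact_mod_cast hj)
    (uniqueDiffOn_Icc hab) x hx).hasDerivWithinAt

lemma IsClassC.contRect {m n : ℕ} {l T : ℝ} {g : ℝ → ℝ → ℝ} (h : IsClassC m n l T g) :
    ContRect l T g := by
  have := h.2.2.1 0 (Nat.zero_le _)
  simpa only [iteratedDerivWithin_zero] using this

lemma IsClassC.contRect_pdx {m n : ℕ} {l T : ℝ} {g : ℝ → ℝ → ℝ} (h : IsClassC m n l T g)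
    (hm : 1 ≤ m) : ContRect l T (pdx l g) := by
  have := h.2.2.1 1 hm
  simp only [iteratedDerivWithin_one] at this
  exact this

lemma IsClassC.contRect_pdt {m n : ℕ} {l T : ℝ} {g : ℝ → ℝ → ℝ} (h : IsClassC m n l T g)
    (hn : 1 ≤ n) : ContRect l T (pdt T g) := by
  have := h.2.2.2 1 hn
  simp only [iteratedDerivWithin_one] at this
  exact this

lemma IsClassC.hasDerivWithinAt_pdx {m n : ℕ} {l T : ℝ} {g : ℝ → ℝ → ℝ}
    (h : IsClassC m n l T g) (hm : 1 ≤ m) {x t : ℝ} (hx : x ∈ Icc 0 l) (ht : t ∈ Icc 0 T) :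
    HasDerivWithinAt (fun x => g x t) (pdx l g x t) (Icc 0 l) x :=
  ((h.1 t ht).differentiableOn (by exact_mod_cast (Nat.pos_iff_ne_zero.1 hm)) x hx).hasDerivWithinAt

lemma IsClassC.hasDerivWithinAt_pdt {m n : ℕ} {l T : ℝ} {g : ℝ → ℝ → ℝ}
    (h : IsClassC m n l T g) (hn : 1 ≤ n) {x t : ℝ} (hx : x ∈ Icc 0 l) (ht : t ∈ Icc 0 T) :
    HasDerivWithinAt (g x) (pdt T g x t) (Icc 0 T) t :=
  ((h.2.1 x hx).differentiableOn (by exact_mod_cast (Nat.pos_iff_ne_zero.1 hn)) t ht).hasDerivWithinAt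

/-- The second derivative `g_xx(x,t)`, one-sided at `x = 0` and `x = l`. -/
def pdxx (l : ℝ) (g : ℝ → ℝ → ℝ) (x t : ℝ) : ℝ :=
  iteratedDerivWithin 2 (fun ξ => g ξ t) (Icc 0 l) x

/-- The second derivative `g_tt(x,t)`, one-sided at `t = 0` and `t = T`. -/
def pdtt (T : ℝ) (g : ℝ → ℝ → ℝ) (x t : ℝ) : ℝ :=
  iteratedDerivWithin 2 (fun τ => g x τ) (Icc 0 T) t

lemma IsClassC.hasDerivWithinAt_pdxx {m n : ℕ} {l T : ℝ} {g : ℝ → ℝ → ℝ}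
    (h : IsClassC m n l T g) (hl : 0 < l) (hm : 2 ≤ m) {x t : ℝ} (hx : x ∈ Icc 0 l)
    (ht : t ∈ Icc 0 T) :
    HasDerivWithinAt (fun x => pdx l g x t) (pdxx l g x t) (Icc 0 l) x := by
  have := hasDerivWithinAt_iteratedDerivWithin (j := 1) hl (h.1 t ht) (by omega) hx
  exact this.congr (fun y _ => by rw [iteratedDerivWithin_one]; rfl)
    (by rw [iteratedDerivWithin_one]; rfl)

lemma IsClassC.hasDerivWithinAt_pdtt {m n : ℕ} {l T : ℝ} {g : ℝ → ℝ → ℝ}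
    (h : IsClassC m n l T g) (hT : 0 < T) (hn : 2 ≤ n) {x t : ℝ} (hx : x ∈ Icc 0 l)
    (ht : t ∈ Icc 0 T) :
    HasDerivWithinAt (pdt T g x) (pdtt T g x t) (Icc 0 T) t := by
  have := hasDerivWithinAt_iteratedDerivWithin (j := 1) hT (h.2.1 x hx) (by omega) ht
  exact this.congr (fun y _ => by rw [iteratedDerivWithin_one]; rfl)
    (by rw [iteratedDerivWithin_one]; rfl)

/-- The flux divergence `(k u_x)_x`, expanded by the product rule. -/
def fluxDiv (l : ℝ) (k u : ℝ → ℝ → ℝ) (x t : ℝ) : ℝ :=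
  pdx l k x t * pdx l u x t + k x t * pdxx l u x t

/-- The right-hand side `(k u_x)_x - q u + f` of the equation. -/
def waveRhs (l : ℝ) (k q f u : ℝ → ℝ → ℝ) (x t : ℝ) : ℝ :=
  fluxDiv l k u x t - q x t * u x t + f x t

lemma pdx_flux {m n m' n' : ℕ} {l T : ℝ} {k u : ℝ → ℝ → ℝ} (hl : 0 < l)
    (hk : IsClassC m n l T k) (hm : 1 ≤ m) (hu : IsClassC m' n' l T u) (hm' : 2 ≤ m') {x t : ℝ}
    (hx : x ∈ Icc 0 l) (ht : t ∈ Icc 0 T) :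
    pdx l (fun ξ τ => k ξ τ * pdx l u ξ τ) x t = fluxDiv l k u x t :=
  ((hk.hasDerivWithinAt_pdx hm hx ht).mul
    (hu.hasDerivWithinAt_pdxx hl hm' hx ht)).derivWithin (uniqueDiffOn_Icc hl x hx)

/-! ### The energy and its balance law. -/

/-- The total energy of the third boundary value problem. -/
def robinEnergy (l : ℝ) (k q : ℝ → ℝ → ℝ) (β₁ β₂ μ₁ μ₂ : ℝ → ℝ) (u : ℝ → ℝ → ℝ) (t : ℝ) : ℝ :=
  1 / 2 * (∫ x in (0 : ℝ)..l, k x t * pdx l u x t ^ 2)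
    + 1 / 2 * (∫ x in (0 : ℝ)..l, q x t * u x t ^ 2)
    + 1 / 2 * (β₁ t * u 0 t ^ 2) + 1 / 2 * (β₂ t * u l t ^ 2) - μ₁ t * u 0 t - μ₂ t * u l t

/-- The rate of change of the energy caused by the time dependence of the coefficients. -/
def energyRate (l T : ℝ) (k q : ℝ → ℝ → ℝ) (β₁ β₂ μ₁ μ₂ : ℝ → ℝ) (u : ℝ → ℝ → ℝ) (t : ℝ) : ℝ :=
  1 / 2 * (∫ x in (0 : ℝ)..l, pdt T k x t * pdx l u x t ^ 2)
    + 1 / 2 * (∫ x in (0 : ℝ)..l, pdt T q x t * u x t ^ 2)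
    + 1 / 2 * (derivWithin β₁ (Icc 0 T) t * u 0 t ^ 2)
    + 1 / 2 * (derivWithin β₂ (Icc 0 T) t * u l t ^ 2)
    - derivWithin μ₁ (Icc 0 T) t * u 0 t - derivWithin μ₂ (Icc 0 T) t * u l t

section Energy

variable {α l T : ℝ} {k q f : ℝ → ℝ → ℝ} {β₁ β₂ μ₁ μ₂ u₀ u₁ : ℝ → ℝ} {u : ℝ → ℝ → ℝ}

/-- The boundary flux `k u_x u_t` produced by the elastic part equals, by the Robin conditions, the
`u_t` part of the derivative of `½ β_i u² - μ_i u` with opposite sign. What remains besides the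
derivatives of the coefficients and of `μ_i` is the spatial operator tested with `u_t`. -/
lemma IsRobinSolution.hasDerivWithinAt_energy (hl : 0 < l)
    (hk : IsClassC 1 1 l T k) (hq : IsClassC 0 1 l T q)
    (hβ₁ : ContDiffOn ℝ 1 β₁ (Icc 0 T)) (hβ₂ : ContDiffOn ℝ 1 β₂ (Icc 0 T))
    (hμ₁ : ContDiffOn ℝ 1 μ₁ (Icc 0 T)) (hμ₂ : ContDiffOn ℝ 1 μ₂ (Icc 0 T))
    (hu : IsRobinSolution α l T k q f β₁ β₂ μ₁ μ₂ u₀ u₁ u) {t : ℝ} (ht : t ∈ Icc 0 T) :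
    HasDerivWithinAt (robinEnergy l k q β₁ β₂ μ₁ μ₂ u)
      (energyRate l T k q β₁ β₂ μ₁ μ₂ u t -
        ∫ x in (0 : ℝ)..l, (fluxDiv l k u x t - q x t * u x t) * pdt T u x t) (Icc 0 T) t := by
  have hr := hu.regular
  have h0 : (0 : ℝ) ∈ Icc 0 l := ⟨le_rfl, hl.le⟩
  have hll : l ∈ Icc 0 l := ⟨hl.le, le_rfl⟩
  have cuxx : ContRect l T (pdxx l u) := hr.2.2.1 2 le_rfl
  have cut := hr.contRect_pdt one_le_two
  have cux := hr.contRect_pdx one_le_two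
  have d1 := hasDerivWithinAt_elastic hl.le hk.contRect (hk.contRect_pdx le_rfl)
    (hk.contRect_pdt le_rfl) hr.contRect cux cuxx cut
    (fun t ht x hx => hk.hasDerivWithinAt_pdx le_rfl hx ht)
    (fun x hx t ht => hk.hasDerivWithinAt_pdt le_rfl hx ht)
    (fun t ht x hx => hr.hasDerivWithinAt_pdx one_le_two hx ht)
    (fun t ht x hx => hr.hasDerivWithinAt_pdxx hl le_rfl hx ht)
    (fun x hx t ht => hr.hasDerivWithinAt_pdt one_le_two hx ht) ht
  have cqt : ContRect l T (fun x t => pdt T q x t * u x t ^ 2) :=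
    (hq.contRect_pdt le_rfl).mul (hr.contRect.pow 2)
  have cqu : ContRect l T (fun x t => q x t * u x t * pdt T u x t) :=
    (hq.contRect.mul hr.contRect).mul cut
  have d2 := hasDerivWithinAt_integral (g := fun x t => q x t * u x t ^ 2)
    (g' := fun x t => pdt T q x t * u x t ^ 2 + 2 * (q x t * u x t * pdt T u x t)) hl.le
    (hq.contRect.mul (hr.contRect.pow 2)) (cqt.add (continuousOn_const.mul cqu))
    (by
      intro x hx t ht
      refine ((hq.hasDerivWithinAt_pdt le_rfl hx ht).mul
        ((hr.hasDerivWithinAt_pdt one_le_two hx ht).pow 2)).congr_deriv ?_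
      simp
      ring) ht
  rw [intervalIntegral.integral_add (cqt.intervalIntegrable hl.le ht)
    ((cqu.intervalIntegrable hl.le ht).const_mul 2), intervalIntegral.integral_const_mul] at d2
  have db : ∀ {γ : ℝ → ℝ}, ContDiffOn ℝ 1 γ (Icc 0 T) →
      HasDerivWithinAt γ (derivWithin γ (Icc 0 T) t) (Icc 0 T) t := fun hγ =>
    (hγ.differentiableOn one_ne_zero t ht).hasDerivWithinAt
  have du0 := hr.hasDerivWithinAt_pdt one_le_two h0 ht
  have dul := hr.hasDerivWithinAt_pdt one_le_two hll ht
  have key := (((((d1.const_mul (1 / 2)).add (d2.const_mul (1 / 2))).add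
    (((db hβ₁).mul (du0.pow 2)).const_mul (1 / 2))).add
    (((db hβ₂).mul (dul.pow 2)).const_mul (1 / 2))).sub ((db hμ₁).mul du0)).sub ((db hμ₂).mul dul)
  refine key.congr_deriv ?_
  have cflux : ContRect l T (fun x t => fluxDiv l k u x t * pdt T u x t) :=
    (((hk.contRect_pdx le_rfl).mul cux).add (hk.contRect.mul cuxx)).mul cut
  have e : ∫ x in (0 : ℝ)..l, (fluxDiv l k u x t - q x t * u x t) * pdt T u x t =
      (∫ x in (0 : ℝ)..l, (pdx l k x t * pdx l u x t + k x t * pdxx l u x t) * pdt T u x t) -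
      ∫ x in (0 : ℝ)..l, q x t * u x t * pdt T u x t := by
    change _ = (∫ x in (0 : ℝ)..l, fluxDiv l k u x t * pdt T u x t) - _
    rw [← intervalIntegral.integral_sub (cflux.intervalIntegrable hl.le ht)
      (cqu.intervalIntegrable hl.le ht)]
    congr 1
    ext x
    simp only [fluxDiv]
    ring
  have b0 := hu.left_boundary t ht
  have bl := hu.right_boundary t ht
  rw [e, energyRate]
  have bl' : k l t * pdx l u l t = -(β₂ t * u l t - μ₂ t) := by linarith
  rw [b0, bl']
  simp
  ring

end Energy

/-! ### Bounds for weighted norms, Young's inequality and fractional integrals. -/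

lemma integral_mul_sq_le {a w : ℝ → ℝ} {l c : ℝ} (hl : 0 ≤ l) (ha : ContinuousOn a (Icc 0 l))
    (hw : ContinuousOn w (Icc 0 l)) (h : ∀ x ∈ Icc 0 l, a x ≤ c) :
    ∫ x in (0 : ℝ)..l, a x * w x ^ 2 ≤ c * normSq l w := by
  rw [normSq, ← intervalIntegral.integral_const_mul]
  refine intervalIntegral.integral_mono_on hl ?_ ?_ fun x hx =>
    mul_le_mul_of_nonneg_right (h x hx) (sq_nonneg _)
  · exact ContinuousOn.intervalIntegrable (by rw [uIcc_of_le hl]; exact ha.mul (hw.pow 2))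
  · exact ContinuousOn.intervalIntegrable
      (by rw [uIcc_of_le hl]; exact continuousOn_const.mul (hw.pow 2))

lemma le_integral_mul_sq {a w : ℝ → ℝ} {l c : ℝ} (hl : 0 ≤ l) (ha : ContinuousOn a (Icc 0 l))
    (hw : ContinuousOn w (Icc 0 l)) (h : ∀ x ∈ Icc 0 l, c ≤ a x) :
    c * normSq l w ≤ ∫ x in (0 : ℝ)..l, a x * w x ^ 2 := by
  have := integral_mul_sq_le hl ha.neg hw (c := -c) fun x hx => neg_le_neg (h x hx)
  simp only [Pi.neg_apply, neg_mul, intervalIntegral.integral_neg] at this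
  linarith

lemma normSq_nonneg {l : ℝ} (hl : 0 ≤ l) (w : ℝ → ℝ) : 0 ≤ normSq l w :=
  intervalIntegral.integral_nonneg hl fun _ _ => sq_nonneg _

lemma normSq_congr {l : ℝ} (hl : 0 ≤ l) {v w : ℝ → ℝ} (h : EqOn v w (Icc 0 l)) :
    normSq l v = normSq l w := by
  refine intervalIntegral.integral_congr fun x hx => ?_
  rw [uIcc_of_le hl] at hx
  simp only [h hx]

lemma ContRect.continuousOn_normSq {l T : ℝ} {g : ℝ → ℝ → ℝ} (hl : 0 ≤ l) (hT : 0 ≤ T)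
    (hg : ContRect l T g) : ContinuousOn (fun t => normSq l (fun x => g x t)) (Icc 0 T) :=
  continuousOn_integral_fst (g := fun x t => g x t ^ 2) hl hT (hg.pow 2)

lemma integral_mul_le_eps {v w : ℝ → ℝ} {l ε : ℝ} (hl : 0 ≤ l) (hε : 0 < ε)
    (hv : ContinuousOn v (Icc 0 l)) (hw : ContinuousOn w (Icc 0 l)) :
    ∫ x in (0 : ℝ)..l, v x * w x ≤ ε * normSq l w + 1 / (4 * ε) * normSq l v := by
  have i : ∀ {g : ℝ → ℝ}, ContinuousOn g (Icc 0 l) → IntervalIntegrable g volume 0 l := by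
    intro g hg
    apply ContinuousOn.intervalIntegrable
    rwa [uIcc_of_le hl]
  have i1 : IntervalIntegrable (fun x => ε * w x ^ 2) volume 0 l :=
    i (continuousOn_const.mul (hw.pow 2))
  have i2 : IntervalIntegrable (fun x => 1 / (4 * ε) * v x ^ 2) volume 0 l :=
    i (continuousOn_const.mul (hv.pow 2))
  rw [normSq, normSq, ← intervalIntegral.integral_const_mul,
    ← intervalIntegral.integral_const_mul, ← intervalIntegral.integral_add i1 i2]
  refine intervalIntegral.integral_mono_on hl (i (hv.mul hw)) (i1.add i2) fun x _ => ?_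
  have : ε * w x ^ 2 + 1 / (4 * ε) * v x ^ 2 - v x * w x = (2 * ε * w x - v x) ^ 2 / (4 * ε) := by
    field_simp
    ring
  have h2 : 0 ≤ (2 * ε * w x - v x) ^ 2 / (4 * ε) := by positivity
  linarith

lemma abs_le_supNorm {T : ℝ} {μ : ℝ → ℝ} (hμ : ContinuousOn μ (Icc 0 T)) {t : ℝ}
    (ht : t ∈ Icc 0 T) : |μ t| ≤ supNorm T μ :=
  le_csSup (isCompact_Icc.image_of_continuousOn hμ.abs).bddAbove (mem_image_of_mem _ ht)

lemma sq_le_supNorm_sq {T : ℝ} {μ : ℝ → ℝ} (hμ : ContinuousOn μ (Icc 0 T)) {t : ℝ}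
    (ht : t ∈ Icc 0 T) : μ t ^ 2 ≤ supNorm T μ ^ 2 := by
  rw [← sq_abs]
  exact pow_le_pow_left₀ (abs_nonneg _) (abs_le_supNorm hμ ht) 2

lemma rlIntegral_nonneg {γ t : ℝ} {h : ℝ → ℝ} (hγ : 0 < γ) (ht : 0 ≤ t) (hh : ∀ τ, 0 ≤ h τ) :
    0 ≤ rlIntegral γ h t := by
  refine mul_nonneg (one_div_nonneg.2 (Real.Gamma_pos_of_pos hγ).le) ?_
  exact intervalIntegral.integral_nonneg ht fun τ hτ =>
    mul_nonneg (hh τ) (Real.rpow_nonneg (sub_nonneg.2 hτ.2) _)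

/-- On `(0,t)` one has `t - τ ≤ T`, so the kernel is at least `T^(-α)`. This lets the fractional
kinetic term absorb `∫ ‖u_t‖²`. -/
lemma integral_le_mul_rlIntegral {α T t : ℝ} {h : ℝ → ℝ} (hα : α ∈ Ioo (0 : ℝ) 1)
    (ht : t ∈ Icc 0 T) (hh : ∀ τ, 0 ≤ h τ) (hc : ContinuousOn h (Icc 0 t)) :
    ∫ τ in (0 : ℝ)..t, h τ ≤ T ^ α * Real.Gamma (1 - α) * rlIntegral (1 - α) h t := by
  have hΓ : 0 < Real.Gamma (1 - α) := Real.Gamma_pos_of_pos (sub_pos.2 hα.2)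
  have e : T ^ α * Real.Gamma (1 - α) * rlIntegral (1 - α) h t =
      ∫ τ in (0 : ℝ)..t, T ^ α * (h τ * (t - τ) ^ (-α)) := by
    rw [rlIntegral, intervalIntegral.integral_const_mul, show 1 - α - 1 = -α by ring]
    field_simp
  rw [e]
  refine intervalIntegral.integral_mono_on_of_le_Ioo ht.1
    (ContinuousOn.intervalIntegrable (by rwa [uIcc_of_le ht.1]))
    ((intervalIntegrable_mul_sub_rpow ht.1 (by linarith [hα.2]) hc).const_mul _) fun τ hτ => ?_
  have hp : 0 < t - τ := sub_pos.2 hτ.2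
  have h1 : 1 ≤ T ^ α * (t - τ) ^ (-α) := by
    rw [Real.rpow_neg hp.le, ← div_eq_mul_inv, one_le_div (Real.rpow_pos_of_pos hp _)]
    exact Real.rpow_le_rpow hp.le (by linarith [hτ.1, ht.2]) hα.1.le
  calc h τ = h τ * 1 := (mul_one _).symm
    _ ≤ h τ * (T ^ α * (t - τ) ^ (-α)) := mul_le_mul_of_nonneg_left h1 (hh τ)
    _ = _ := by ring

/-! ### Bounds for the energy, its rate and the fractional kinetic term. -/

/-- The squared `W₂¹` norm of `u(·,t)` together with its squared boundary values. -/
def traceSobolevSq (l : ℝ) (u : ℝ → ℝ → ℝ) (t : ℝ) : ℝ :=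
  sobolevNormSq l (fun x => u x t) + (u 0 t ^ 2 + u l t ^ 2)

section Estimates

variable {α l T c₁ c₂ c₃ c₄ m₁ m₂ β b : ℝ} {k q f : ℝ → ℝ → ℝ} {β₁ β₂ μ₁ μ₂ u₀ u₁ : ℝ → ℝ}
  {u : ℝ → ℝ → ℝ}

/-- Coercivity: half of the boundary term `½ β v²` absorbs `μ v` by Young's inequality at the price
`μ² / β`. The other half keeps the boundary values on the left, which accounts for `β / 4`. -/
lemma le_robinEnergy (hl : 0 ≤ l) (hβ : 0 < β)
    (hk : ContRect l T k) (hq : ContRect l T q) (hu : IsClassC 2 2 l T u) {t : ℝ}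
    (ht : t ∈ Icc 0 T) (hkc : ∀ x ∈ Icc 0 l, c₁ ≤ k x t) (hqm : ∀ x ∈ Icc 0 l, m₁ ≤ q x t)
    (hb : β ≤ β₁ t ∧ β ≤ β₂ t) :
    min (min (c₁ / 2) (m₁ / 2)) (β / 4) * traceSobolevSq l u t ≤
      robinEnergy l k q β₁ β₂ μ₁ μ₂ u t + 1 / β * (μ₁ t ^ 2 + μ₂ t ^ 2) := by
  have hD := le_integral_mul_sq hl (hk.left ht) ((hu.contRect_pdx one_le_two).left ht) hkc
  have hN := le_integral_mul_sq hl (hq.left ht) (hu.contRect.left ht) hqm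
  set κ := min (min (c₁ / 2) (m₁ / 2)) (β / 4)
  have k1 : κ ≤ c₁ / 2 := (min_le_left _ _).trans (min_le_left _ _)
  have k2 : κ ≤ m₁ / 2 := (min_le_left _ _).trans (min_le_right _ _)
  have k3 : κ ≤ β / 4 := min_le_right _ _
  have e : traceSobolevSq l u t = normSq l (fun x => u x t) + normSq l (fun x => pdx l u x t) +
    (u 0 t ^ 2 + u l t ^ 2) := rfl
  have y1 := mul_le_mul_of_nonneg_right k1 (normSq_nonneg hl fun x => pdx l u x t)
  have y2 := mul_le_mul_of_nonneg_right k2 (normSq_nonneg hl fun x => u x t)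
  have y3 := mul_le_mul_of_nonneg_right k3 (sq_nonneg (u 0 t))
  have y4 := mul_le_mul_of_nonneg_right k3 (sq_nonneg (u l t))
  have young : ∀ {γ m v : ℝ}, β ≤ γ → β / 4 * v ^ 2 ≤ 1 / 2 * (γ * v ^ 2) - m * v + 1 / β * m ^ 2 := by
    intro γ m v h
    have h1 : β / 4 * v ^ 2 - m * v + 1 / β * m ^ 2 = (β * v - 2 * m) ^ 2 / (4 * β) := by
      field_simp
      ring
    have h2 : 0 ≤ (β * v - 2 * m) ^ 2 / (4 * β) := by positivity
    nlinarith [mul_le_mul_of_nonneg_right h (sq_nonneg v)]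
  have z1 := young (m := μ₁ t) (v := u 0 t) hb.1
  have z2 := young (m := μ₂ t) (v := u l t) hb.2
  rw [e, robinEnergy]
  linarith

/-- The trace inequality bounds the initial boundary values by the `W₂¹` norm; this is where `b`
enters. Absolute values are taken because no sign of `c₂`, `m₂` or `b` is assumed. -/
lemma robinEnergy_zero_le (hl : 0 < l) (hT : 0 ≤ T)
    (hk : ContRect l T k) (hq : ContRect l T q) (hu : IsClassC 2 2 l T u)
    (hkc : ∀ x ∈ Icc 0 l, k x 0 ≤ c₂) (hqm : ∀ x ∈ Icc 0 l, q x 0 ≤ m₂)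
    (hb₁ : β₁ 0 ≤ b) (hb₂ : β₂ 0 ≤ b) :
    robinEnergy l k q β₁ β₂ μ₁ μ₂ u 0 ≤
      (|c₂| + |m₂| + (|b| + 1) * (1 / l + 1)) * sobolevNormSq l (fun x => u x 0) +
        (μ₁ 0 ^ 2 + μ₂ 0 ^ 2) := by
  have h0T : (0 : ℝ) ∈ Icc 0 T := ⟨le_rfl, hT⟩
  have cx := (hu.contRect_pdx one_le_two).left h0T
  have hD := integral_mul_sq_le hl.le (hk.left h0T) cx fun x hx => (hkc x hx).trans (le_abs_self _)
  have hN := integral_mul_sq_le hl.le (hq.left h0T) (hu.contRect.left h0T)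
    fun x hx => (hqm x hx).trans (le_abs_self _)
  have dx := fun x hx => hu.hasDerivWithinAt_pdx one_le_two (x := x) hx h0T
  have t0 : u 0 0 ^ 2 ≤ (1 / l + 1) * sobolevNormSq l (fun x => u x 0) :=
    sq_le_trace hl ⟨le_rfl, hl.le⟩ dx cx
  have tl : u l 0 ^ 2 ≤ (1 / l + 1) * sobolevNormSq l (fun x => u x 0) :=
    sq_le_trace hl ⟨hl.le, le_rfl⟩ dx cx
  have e : sobolevNormSq l (fun x => u x 0) =
    normSq l (fun x => u x 0) + normSq l (fun x => pdx l u x 0) := rfl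
  have n0 := normSq_nonneg hl.le fun x => u x 0
  have d0 := normSq_nonneg hl.le fun x => pdx l u x 0
  have hc0 := abs_nonneg c₂
  have hm0 := abs_nonneg m₂
  have young : ∀ {γ m v : ℝ}, γ ≤ b → v ^ 2 ≤ (1 / l + 1) * sobolevNormSq l (fun x => u x 0) →
      1 / 2 * (γ * v ^ 2) - m * v ≤
        (|b| + 1) / 2 * ((1 / l + 1) * sobolevNormSq l (fun x => u x 0)) + m ^ 2 := by
    intro γ m v h hv
    have h1 : γ * v ^ 2 ≤ |b| * v ^ 2 :=
      mul_le_mul_of_nonneg_right (h.trans (le_abs_self b)) (sq_nonneg v)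
    have h2 := mul_le_mul_of_nonneg_left hv (by positivity : 0 ≤ (|b| + 1) / 2)
    nlinarith [sq_nonneg (m + v), sq_nonneg m]
  have z1 := young (m := μ₁ 0) hb₁ t0
  have z2 := young (m := μ₂ 0) hb₂ tl
  have p1 := mul_nonneg hc0 n0
  have p2 := mul_nonneg hm0 d0
  have p3 := mul_nonneg hc0 d0
  have p4 := mul_nonneg hm0 n0
  have expand : (|c₂| + |m₂| + (|b| + 1) * (1 / l + 1)) * sobolevNormSq l (fun x => u x 0) =
      |c₂| * normSq l (fun x => u x 0) + |c₂| * normSq l (fun x => pdx l u x 0) +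
      (|m₂| * normSq l (fun x => u x 0) + |m₂| * normSq l (fun x => pdx l u x 0)) +
      2 * ((|b| + 1) / 2 * ((1 / l + 1) * sobolevNormSq l (fun x => u x 0))) := by
    rw [e]; ring
  rw [expand, robinEnergy]
  linarith

/-- The boundary values are part of `traceSobolevSq`, so Young's inequality suffices here and no
trace inequality is needed at positive times. -/
lemma energyRate_le (hl : 0 ≤ l) (hk : ContRect l T (pdt T k)) (hq : ContRect l T (pdt T q))
    (hu : IsClassC 2 2 l T u) {t : ℝ} (ht : t ∈ Icc 0 T)
    (hkq : ∀ x ∈ Icc 0 l, |pdt T k x t| ≤ c₃ ∧ |pdt T q x t| ≤ c₃)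
    (hb : |derivWithin β₁ (Icc 0 T) t| ≤ c₄ ∧ |derivWithin β₂ (Icc 0 T) t| ≤ c₄) :
    energyRate l T k q β₁ β₂ μ₁ μ₂ u t ≤ (|c₃| + |c₄| + 1) * traceSobolevSq l u t +
      (derivWithin μ₁ (Icc 0 T) t ^ 2 + derivWithin μ₂ (Icc 0 T) t ^ 2) := by
  have hD := integral_mul_sq_le hl (hk.left ht) ((hu.contRect_pdx one_le_two).left ht)
    fun x hx => ((le_abs_self _).trans (hkq x hx).1).trans (le_abs_self _)
  have hN := integral_mul_sq_le hl (hq.left ht) (hu.contRect.left ht)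
    fun x hx => ((le_abs_self _).trans (hkq x hx).2).trans (le_abs_self _)
  have n0 := normSq_nonneg hl fun x => u x t
  have d0 := normSq_nonneg hl fun x => pdx l u x t
  have young : ∀ {γ m v : ℝ}, |γ| ≤ c₄ →
      1 / 2 * (γ * v ^ 2) - m * v ≤ (|c₄| + 1) * v ^ 2 + m ^ 2 := by
    intro γ m v h
    have h1 : γ * v ^ 2 ≤ |c₄| * v ^ 2 :=
      mul_le_mul_of_nonneg_right (((le_abs_self _).trans h).trans (le_abs_self _)) (sq_nonneg v)
    have h2 := mul_nonneg (abs_nonneg c₄) (sq_nonneg v)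
    nlinarith [sq_nonneg (m + v), sq_nonneg m, sq_nonneg v]
  have z1 := young (m := derivWithin μ₁ (Icc 0 T) t) (v := u 0 t) hb.1
  have z2 := young (m := derivWithin μ₂ (Icc 0 T) t) (v := u l t) hb.2
  have e : traceSobolevSq l u t = normSq l (fun x => u x t) + normSq l (fun x => pdx l u x t) +
    (u 0 t ^ 2 + u l t ^ 2) := rfl
  have p1 := mul_nonneg (abs_nonneg c₃) n0
  have p2 := mul_nonneg (abs_nonneg c₃) d0
  have p3 := mul_nonneg (abs_nonneg c₄) n0
  have p4 := mul_nonneg (abs_nonneg c₄) d0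
  have p5 := mul_nonneg (abs_nonneg c₃) (sq_nonneg (u 0 t))
  have p6 := mul_nonneg (abs_nonneg c₃) (sq_nonneg (u l t))
  rw [e, energyRate]
  linarith

/-- The pointwise-in-`x` fractional inequality for `u_t(x,·)` is integrated over `x`, and the
integrals are exchanged. The equation supplies the continuous representative `Γ(1-α) * waveRhs` of
the Caputo integral. -/
lemma IsRobinSolution.kinetic_le (hα : α ∈ Ioo (0 : ℝ) 1) (hl : 0 < l) (hT : 0 < T)
    (hk : IsClassC 1 1 l T k) (hq : IsClassC 0 1 l T q) (hf : ContRect l T f)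
    (hu : IsRobinSolution α l T k q f β₁ β₂ μ₁ μ₂ u₀ u₁ u) {t : ℝ} (ht : t ∈ Icc 0 T) :
    1 / 2 * (rlIntegral (1 - α) (fun τ => normSq l (fun x => pdt T u x τ)) t -
        normSq l (fun x => pdt T u x 0) * (t ^ (1 - α) / ((1 - α) * Real.Gamma (1 - α)))) ≤
      ∫ τ in (0 : ℝ)..t, ∫ x in (0 : ℝ)..l, pdt T u x τ * waveRhs l k q f u x τ := by
  have hr := hu.regular
  have hΓ : 0 < Real.Gamma (1 - α) := Real.Gamma_pos_of_pos (sub_pos.2 hα.2)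
  have h1α : 0 < 1 - α := sub_pos.2 hα.2
  have hr' : -1 < -α := by linarith [hα.2]
  have h0T : (0 : ℝ) ∈ Icc 0 T := ⟨le_rfl, hT.le⟩
  have hsub : Icc 0 t ⊆ Icc 0 T := Icc_subset_Icc_right ht.2
  have cut := hr.contRect_pdt one_le_two
  have cutt : ContRect l T (pdtt T u) := hr.2.2.2 2 le_rfl
  have cuxx : ContRect l T (pdxx l u) := hr.2.2.1 2 le_rfl
  have cW : ContRect l T (waveRhs l k q f u) :=
    ((((hk.contRect_pdx le_rfl).mul (hr.contRect_pdx one_le_two)).add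
      (hk.contRect.mul cuxx)).sub (hq.contRect.mul hr.contRect)).add hf
  have ikernel : IntervalIntegrable (fun τ => (t - τ) ^ (-α)) volume 0 t := by
    simpa using intervalIntegrable_mul_sub_rpow (g := fun _ => 1) ht.1 hr' continuousOn_const
  obtain ⟨i1, s1⟩ := integral_swap_mul_weight (g := fun x τ => pdt T u x τ ^ 2) hl.le ht
    (cut.pow 2) ikernel
  obtain ⟨i2, s2⟩ := integral_swap_mul_weight
    (g := fun x τ => pdt T u x τ * waveRhs l k q f u x τ) (φ := fun _ => 1) hl.le ht
    (cut.mul cW) (by simp)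
  simp only [mul_one] at i2 s2
  have i3 : IntervalIntegrable (fun x => pdt T u x 0 ^ 2 * (t ^ (1 - α) / (1 - α))) volume 0 l :=
    ContRect.intervalIntegrable (g := fun x s => pdt T u x s ^ 2 * (t ^ (1 - α) / (1 - α)))
      (T := T) ((cut.pow 2).mul continuousOn_const) hl.le h0T
  have key := intervalIntegral.integral_mono_on_of_le_Ioo hl.le ((i1.sub i3).const_mul (1 / 2))
    (i2.const_mul (Real.Gamma (1 - α))) (by
      intro x hx
      have hx' := Ioo_subset_Icc_self hx
      have := half_fractional_energy_le (v := pdt T u x) (v' := pdtt T u x)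
        (W := fun s => Real.Gamma (1 - α) * waveRhs l k q f u x s) ht.1 hα
        (fun τ hτ => (hr.hasDerivWithinAt_pdtt hT le_rfl hx' (hsub hτ)).mono hsub)
        ((cutt.right hx').mono hsub) (continuousOn_const.mul ((cW.right hx').mono hsub))
        (by
          intro s hs
          have hs' : s ∈ Ioc 0 T := ⟨hs.1, hs.2.trans ht.2⟩
          have eq := hu.equation x hx s hs'
          rw [pdx_flux hl hk le_rfl hr le_rfl hx' ⟨hs'.1.le, hs'.2⟩] at eq
          rw [waveRhs, ← eq, caputo]
          field_simp
          rfl)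
      refine this.trans (le_of_eq ?_)
      rw [← intervalIntegral.integral_const_mul]
      congr 1
      ext s
      ring)
  rw [intervalIntegral.integral_const_mul, intervalIntegral.integral_const_mul,
    intervalIntegral.integral_sub i1 i3, s1, s2, intervalIntegral.integral_mul_const] at key
  rw [← mul_le_mul_iff_of_pos_left hΓ]
  refine le_trans (le_of_eq ?_) key
  rw [rlIntegral, show 1 - α - 1 = -α by ring]
  simp only [normSq]
  field_simp

end Estimates

/-! ### The integrated energy inequality. -/

section Estimates

variable {α l T c₁ c₂ c₃ c₄ m₁ m₂ β b : ℝ} {k q f : ℝ → ℝ → ℝ} {β₁ β₂ μ₁ μ₂ u₀ u₁ : ℝ → ℝ}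
  {u : ℝ → ℝ → ℝ}

/-- The source terms `‖f‖₀² + μ₁'² + μ₂'²` at time `t`. -/
def sourceSq (l T : ℝ) (f : ℝ → ℝ → ℝ) (μ₁ μ₂ : ℝ → ℝ) (t : ℝ) : ℝ :=
  normSq l (fun x => f x t) + derivWithin μ₁ (Icc 0 T) t ^ 2 + derivWithin μ₂ (Icc 0 T) t ^ 2

lemma sourceSq_nonneg (hl : 0 ≤ l) (t : ℝ) : 0 ≤ sourceSq l T f μ₁ μ₂ t := by
  have := normSq_nonneg hl fun x => f x t
  rw [sourceSq]
  positivity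

lemma continuousOn_sourceSq (hl : 0 ≤ l) (hT : 0 < T) (hf : ContRect l T f)
    (hμ₁ : ContDiffOn ℝ 1 μ₁ (Icc 0 T)) (hμ₂ : ContDiffOn ℝ 1 μ₂ (Icc 0 T)) :
    ContinuousOn (sourceSq l T f μ₁ μ₂) (Icc 0 T) := by
  have hU := uniqueDiffOn_Icc hT
  exact ((hf.continuousOn_normSq hl hT.le).add
    ((hμ₁.continuousOn_derivWithin hU le_rfl).pow 2)).add
      ((hμ₂.continuousOn_derivWithin hU le_rfl).pow 2)

lemma continuousOn_traceSobolevSq (hl : 0 ≤ l) (hT : 0 ≤ T) (hu : IsClassC 2 2 l T u) :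
    ContinuousOn (traceSobolevSq l u) (Icc 0 T) :=
  ((hu.contRect.continuousOn_normSq hl hT).add
    ((hu.contRect_pdx one_le_two).continuousOn_normSq hl hT)).add
      (((hu.contRect.right ⟨le_rfl, hl⟩).pow 2).add ((hu.contRect.right ⟨hl, le_rfl⟩).pow 2))

lemma continuousOn_energyRate (hl : 0 ≤ l) (hT : 0 < T)
    (hk : IsClassC 1 1 l T k) (hq : IsClassC 0 1 l T q) (hu : IsClassC 2 2 l T u)
    (hβ₁ : ContDiffOn ℝ 1 β₁ (Icc 0 T)) (hβ₂ : ContDiffOn ℝ 1 β₂ (Icc 0 T))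
    (hμ₁ : ContDiffOn ℝ 1 μ₁ (Icc 0 T)) (hμ₂ : ContDiffOn ℝ 1 μ₂ (Icc 0 T)) :
    ContinuousOn (energyRate l T k q β₁ β₂ μ₁ μ₂ u) (Icc 0 T) := by
  have hU := uniqueDiffOn_Icc hT
  have u0 := hu.contRect.right (x := 0) ⟨le_rfl, hl⟩
  have ul := hu.contRect.right (x := l) ⟨hl, le_rfl⟩
  have i1 := continuousOn_integral_fst (g := fun x t => pdt T k x t * pdx l u x t ^ 2) hl hT.le
    ((hk.contRect_pdt le_rfl).mul ((hu.contRect_pdx one_le_two).pow 2))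
  have i2 := continuousOn_integral_fst (g := fun x t => pdt T q x t * u x t ^ 2) hl hT.le
    ((hq.contRect_pdt le_rfl).mul (hu.contRect.pow 2))
  exact (((((continuousOn_const.mul i1).add (continuousOn_const.mul i2)).add
    (continuousOn_const.mul ((hβ₁.continuousOn_derivWithin hU le_rfl).mul (u0.pow 2)))).add
    (continuousOn_const.mul ((hβ₂.continuousOn_derivWithin hU le_rfl).mul (ul.pow 2)))).sub
    ((hμ₁.continuousOn_derivWithin hU le_rfl).mul u0)).sub
    ((hμ₂.continuousOn_derivWithin hU le_rfl).mul ul)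

/-- In the sum of the energy balance and the kinetic inequality the spatial operator tested with
`u_t` cancels, leaving the coefficient rates and the work of `f`. Absorbing part of that work lowers
the kinetic coefficient from `1/2` to `1/4`. -/
lemma IsRobinSolution.energy_add_kinetic_le (hα : α ∈ Ioo (0 : ℝ) 1) (hl : 0 < l) (hT : 0 < T)
    (hk : IsClassC 1 1 l T k) (hq : IsClassC 0 1 l T q) (hf : ContRect l T f)
    (hkq : ∀ x ∈ Icc 0 l, ∀ t ∈ Icc 0 T, |pdt T k x t| ≤ c₃ ∧ |pdt T q x t| ≤ c₃)
    (hβ₁ : ContDiffOn ℝ 1 β₁ (Icc 0 T)) (hβ₂ : ContDiffOn ℝ 1 β₂ (Icc 0 T))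
    (hμ₁ : ContDiffOn ℝ 1 μ₁ (Icc 0 T)) (hμ₂ : ContDiffOn ℝ 1 μ₂ (Icc 0 T))
    (hb : ∀ t ∈ Icc 0 T,
      |derivWithin β₁ (Icc 0 T) t| ≤ c₄ ∧ |derivWithin β₂ (Icc 0 T) t| ≤ c₄)
    (hu : IsRobinSolution α l T k q f β₁ β₂ μ₁ μ₂ u₀ u₁ u) {t : ℝ} (ht : t ∈ Icc 0 T) :
    robinEnergy l k q β₁ β₂ μ₁ μ₂ u t +
        1 / 4 * rlIntegral (1 - α) (fun τ => normSq l (fun x => pdt T u x τ)) t ≤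
      robinEnergy l k q β₁ β₂ μ₁ μ₂ u 0 +
        T ^ (1 - α) / ((1 - α) * Real.Gamma (1 - α)) * normSq l (fun x => pdt T u x 0) +
        (1 + T ^ α * Real.Gamma (1 - α)) * (∫ τ in (0 : ℝ)..t, sourceSq l T f μ₁ μ₂ τ) +
        (|c₃| + |c₄| + 1) * ∫ τ in (0 : ℝ)..t, traceSobolevSq l u τ := by
  have hr := hu.regular
  have h1α : 0 < 1 - α := sub_pos.2 hα.2
  have hΓ : 0 < Real.Gamma (1 - α) := Real.Gamma_pos_of_pos h1α
  have hsub : Icc 0 t ⊆ Icc 0 T := Icc_subset_Icc_right ht.2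
  have cut := hr.contRect_pdt one_le_two
  have cuxx : ContRect l T (pdxx l u) := hr.2.2.1 2 le_rfl
  have cG : ContRect l T (fun x t => fluxDiv l k u x t - q x t * u x t) :=
    (((hk.contRect_pdx le_rfl).mul (hr.contRect_pdx one_le_two)).add
      (hk.contRect.mul cuxx)).sub (hq.contRect.mul hr.contRect)
  have cGu : ContRect l T (fun x t => (fluxDiv l k u x t - q x t * u x t) * pdt T u x t) :=
    cG.mul cut
  have cuW : ContRect l T (fun x t => pdt T u x t * waveRhs l k q f u x t) :=
    cut.mul (cG.add hf)
  have ii : ∀ {g : ℝ → ℝ}, ContinuousOn g (Icc 0 T) → IntervalIntegrable g volume 0 t := by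
    intro g hg
    apply ContinuousOn.intervalIntegrable
    rw [uIcc_of_le ht.1]
    exact hg.mono hsub
  have iR := ii (continuousOn_energyRate hl.le hT hk hq hr hβ₁ hβ₂ hμ₁ hμ₂)
  have iG := ii (continuousOn_integral_fst hl.le hT.le cGu)
  have iW := ii (continuousOn_integral_fst hl.le hT.le cuW)
  have iS := ii (continuousOn_sourceSq hl.le hT hf hμ₁ hμ₂)
  have iY := ii (continuousOn_traceSobolevSq hl.le hT.le hr)
  have cV := cut.continuousOn_normSq hl.le hT.le
  have iV := ii cV
  have hE := fun s hs =>
    hu.hasDerivWithinAt_energy (t := s) hl hk hq hβ₁ hβ₂ hμ₁ hμ₂ hs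
  have ftc := intervalIntegral.integral_eq_sub_of_hasDerivAt_of_le ht.1
    (f := robinEnergy l k q β₁ β₂ μ₁ μ₂ u)
    (fun s hs => ((hE s (hsub hs)).continuousWithinAt).mono hsub)
    (fun s hs => (hE s (hsub (Ioo_subset_Icc_self hs))).hasDerivAt
      (Icc_mem_nhds hs.1 (hs.2.trans_le ht.2))) (iR.sub iG)
  set A := T ^ α * Real.Gamma (1 - α) with hA
  have hA0 : 0 < A := mul_pos (Real.rpow_pos_of_pos hT _) hΓ
  have bound := intervalIntegral.integral_mono_on ht.1 ((iR.sub iG).add iW)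
    (((iY.const_mul (|c₃| + |c₄| + 1)).add (iS.const_mul (1 + A))).add
      (iV.const_mul (1 / (4 * A)))) (by
      intro s hs
      have hs' := hsub hs
      have r1 := energyRate_le (μ₁ := μ₁) (μ₂ := μ₂) hl.le (hk.contRect_pdt le_rfl)
        (hq.contRect_pdt le_rfl) hr hs' (fun x hx => hkq x hx s hs') (hb s hs')
      -- Since `∫ ‖u_t‖²` is at most `A` times the fractional integral, this `ε` costs exactly a
      -- quarter of that integral, and `‖f‖²` receives the factor `A`.
      have r2 := integral_mul_le_eps (ε := 1 / (4 * A)) hl.le (by positivity) (hf.left hs')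
        (cut.left hs')
      have r3 : (∫ x in (0 : ℝ)..l, pdt T u x s * waveRhs l k q f u x s) =
          (∫ x in (0 : ℝ)..l, (fluxDiv l k u x s - q x s * u x s) * pdt T u x s) +
          ∫ x in (0 : ℝ)..l, f x s * pdt T u x s := by
        rw [← intervalIntegral.integral_add (cGu.intervalIntegrable hl.le hs')
          (ContRect.intervalIntegrable (g := fun x t => f x t * pdt T u x t) (hf.mul cut)
            hl.le hs')]
        congr 1
        ext x
        simp only [waveRhs]
        ring
      have hε : 1 / (4 * (1 / (4 * A))) = A := by field_simp
      rw [hε] at r2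
      have n := normSq_nonneg hl.le fun x => f x s
      have p1 := mul_nonneg hA0.le (sq_nonneg (derivWithin μ₁ (Icc 0 T) s))
      have p2 := mul_nonneg hA0.le (sq_nonneg (derivWithin μ₂ (Icc 0 T) s))
      have e : (1 + A) * sourceSq l T f μ₁ μ₂ s = normSq l (fun x => f x s) +
          A * normSq l (fun x => f x s) +
          (derivWithin μ₁ (Icc 0 T) s ^ 2 + derivWithin μ₂ (Icc 0 T) s ^ 2) +
          (A * derivWithin μ₁ (Icc 0 T) s ^ 2 + A * derivWithin μ₂ (Icc 0 T) s ^ 2) := by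
        rw [sourceSq]; ring
      simp only [r3, e]
      linarith)
  rw [intervalIntegral.integral_add (iR.sub iG) iW, ftc,
    intervalIntegral.integral_add ((iY.const_mul _).add (iS.const_mul _)) (iV.const_mul _),
    intervalIntegral.integral_add (iY.const_mul _) (iS.const_mul _)] at bound
  simp only [intervalIntegral.integral_const_mul] at bound
  have kin := hu.kinetic_le hα hl hT hk hq hf ht
  have hV := integral_le_mul_rlIntegral hα ht
    (h := fun τ => normSq l (fun x => pdt T u x τ)) (fun τ => normSq_nonneg hl.le _) (cV.mono hsub)
  rw [← hA] at hV
  have hV' := mul_le_mul_of_nonneg_left hV (by positivity : 0 ≤ 1 / (4 * A))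
  rw [← mul_assoc (1 / (4 * A)) A, show 1 / (4 * A) * A = 1 / 4 by field_simp] at hV'
  have v0 := normSq_nonneg hl.le fun x => pdt T u x 0
  have hct : t ^ (1 - α) / ((1 - α) * Real.Gamma (1 - α)) ≤
      T ^ (1 - α) / ((1 - α) * Real.Gamma (1 - α)) :=
    div_le_div_of_nonneg_right (Real.rpow_le_rpow ht.1 ht.2 h1α.le) (by positivity)
  have h1 := mul_le_mul_of_nonneg_left hct v0
  have h2 : 0 ≤ T ^ (1 - α) / ((1 - α) * Real.Gamma (1 - α)) := by positivity
  have h3 := mul_nonneg h2 v0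
  linarith

end Estimates

/-! ### Closing the estimate and choosing the constant. -/

/-- An energy inequality with a lower-order term bounds the energy. -/
lemma energy_gronwall {J Y : ℝ → ℝ} {t T a κ K : ℝ} (ht : t ∈ Icc 0 T) (ha : 0 ≤ a) (hκ : 0 < κ)
    (hK : 0 ≤ K) (hJ : ∀ s ∈ Icc 0 t, 0 ≤ J s) (hY : ContinuousOn Y (Icc 0 t))
    (hYt : 0 ≤ Y t)
    (h : ∀ s ∈ Icc 0 t, 1 / 4 * J s + κ * Y s ≤ a + K * ∫ τ in (0 : ℝ)..s, Y τ) :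
    J t + Y t ≤ (4 + 1 / κ) * (1 + K / κ * gronwallBound 0 (K / κ) 1 T) * a := by
  -- Dropping `J ≥ 0` and dividing by `κ` gives a closed inequality for `Y`, hence a bound for its
  -- integral; `J` is recovered afterwards from the original inequality.
  have h1 := integral_le_of_le_add_mul_integral (a := a / κ) (K := K / κ) ht.1 hY (by
    intro s hs
    have h2 : Y s ≤ (a + K * ∫ τ in (0 : ℝ)..s, Y τ) / κ := by
      rw [le_div_iff₀ hκ]
      linarith [h s hs, hJ s hs]
    refine h2.trans (le_of_eq ?_)
    ring)
  rw [gronwallBound_zero_eq_mul] at h1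
  have h2 : gronwallBound 0 (K / κ) 1 t ≤ gronwallBound 0 (K / κ) 1 T :=
    gronwallBound_mono le_rfl zero_le_one (by positivity) ht.2
  have h3 := h1.trans (mul_le_mul_of_nonneg_left h2 (by positivity : 0 ≤ a / κ))
  have h4 := (h t ⟨ht.1, le_rfl⟩).trans
    (add_le_add_right (mul_le_mul_of_nonneg_left h3 hK) a)
  have hJt := hJ t ⟨ht.1, le_rfl⟩
  calc J t + Y t ≤ (4 + 1 / κ) * (1 / 4 * J t + κ * Y t) := by
        have e : (4 + 1 / κ) * (1 / 4 * J t + κ * Y t) =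
          J t + Y t + (4 * (κ * Y t) + 1 / κ * (1 / 4 * J t)) := by field_simp; ring
        have : 0 ≤ 4 * (κ * Y t) + 1 / κ * (1 / 4 * J t) := by positivity
        linarith
    _ ≤ (4 + 1 / κ) * (a + K * (a / κ * gronwallBound 0 (K / κ) 1 T)) :=
        mul_le_mul_of_nonneg_left h4 (by positivity)
    _ = _ := by ring

end FracWave

end

theorem mainTheorem6
    (α l T c₁ c₂ c₃ c₄ m₁ m₂ β b : ℝ)
    (hα : α ∈ Ioo (0 : ℝ) 1) (hl : 0 < l) (hT : 0 < T)
    (hc₁ : 0 < c₁) (hm₁ : 0 < m₁) (hβ : 0 < β) :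
    ∃ M : ℝ, 0 < M ∧
      ∀ (k q f : ℝ → ℝ → ℝ) (β₁ β₂ μ₁ μ₂ u₀ u₁ : ℝ → ℝ) (u : ℝ → ℝ → ℝ),
        FracWave.IsClassC 1 1 l T k →
        FracWave.IsClassC 0 1 l T q →
        ContinuousOn (fun p : ℝ × ℝ => f p.1 p.2) (Icc 0 l ×ˢ Icc 0 T) →
        (∀ x ∈ Icc 0 l, ∀ t ∈ Icc 0 T, c₁ ≤ k x t ∧ k x t ≤ c₂) →
        (∀ x ∈ Icc 0 l, ∀ t ∈ Icc 0 T, m₁ ≤ q x t ∧ q x t ≤ m₂) →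
        (∀ x ∈ Icc 0 l, ∀ t ∈ Icc 0 T,
          |FracWave.pdt T k x t| ≤ c₃ ∧ |FracWave.pdt T q x t| ≤ c₃) →
        ContDiffOn ℝ 1 β₁ (Icc 0 T) → ContDiffOn ℝ 1 β₂ (Icc 0 T) →
        ContDiffOn ℝ 1 μ₁ (Icc 0 T) → ContDiffOn ℝ 1 μ₂ (Icc 0 T) →
        (∀ t ∈ Icc 0 T, β ≤ β₁ t ∧ β ≤ β₂ t) →
        (∀ t ∈ Icc 0 T,
          |derivWithin β₁ (Icc 0 T) t| ≤ c₄ ∧ |derivWithin β₂ (Icc 0 T) t| ≤ c₄) →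
        β₁ 0 ≤ b → β₂ 0 ≤ b →
        FracWave.IsRobinSolution α l T k q f β₁ β₂ μ₁ μ₂ u₀ u₁ u →
        ∀ t ∈ Icc 0 T,
          FracWave.rlIntegral (1 - α)
              (fun τ => FracWave.normSq l (fun x => FracWave.pdt T u x τ)) t
            + FracWave.sobolevNormSq l (fun x => u x t)
          ≤ M * (∫ τ in (0 : ℝ)..t,
                (FracWave.normSq l (fun x => f x τ)
                  + derivWithin μ₁ (Icc 0 T) τ ^ 2 + derivWithin μ₂ (Icc 0 T) τ ^ 2))
            + M * (FracWave.supNorm T μ₁ ^ 2 + FracWave.supNorm T μ₂ ^ 2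
                + FracWave.normSq l u₁ + FracWave.sobolevNormSq l u₀) := by
  have h1α : 0 < 1 - α := sub_pos.2 hα.2
  have hΓ : 0 < Real.Gamma (1 - α) := Real.Gamma_pos_of_pos h1α
  set κ : ℝ := min (min (c₁ / 2) (m₁ / 2)) (β / 4) with hκdef
  have hκ : 0 < κ := by rw [hκdef]; positivity
  set K : ℝ := |c₃| + |c₄| + 1 with hKdef
  have hK : 0 ≤ K := by rw [hKdef]; positivity
  set A : ℝ := T ^ α * Real.Gamma (1 - α) with hAdef
  have hA : 0 < A := mul_pos (Real.rpow_pos_of_pos hT _) hΓ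
  set B : ℝ := T ^ (1 - α) / ((1 - α) * Real.Gamma (1 - α)) with hBdef
  have hB : 0 < B := div_pos (Real.rpow_pos_of_pos hT _) (mul_pos h1α hΓ)
  set E : ℝ := |c₂| + |m₂| + (|b| + 1) * (1 / l + 1) with hEdef
  have hE : 0 < E := by rw [hEdef]; positivity
  -- The summands are the coefficients of the sources (`1 + A`), of `‖u₁‖²` (`B`), of the `W₂¹` norm
  -- of `u₀` (`E`) and of the sup norms of `μ_i`. In the last one, `1` comes from the initial energy
  -- and `1 / β` from coercivity.
  set C : ℝ := (1 + A) + B + E + (1 + 1 / β) with hCdef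
  have hC : 0 < C := by positivity
  set L : ℝ := (4 + 1 / κ) * (1 + K / κ * gronwallBound 0 (K / κ) 1 T) with hLdef
  have hg : 0 ≤ gronwallBound 0 (K / κ) 1 T := by
    have h := gronwallBound_mono le_rfl zero_le_one (div_nonneg hK hκ.le) hT.le
    rwa [gronwallBound_x0] at h
  have hL : 0 < L := by rw [hLdef]; positivity
  refine ⟨L * C, mul_pos hL hC, ?_⟩
  intro k q f β₁ β₂ μ₁ μ₂ u₀ u₁ u hk hq hf hkc hqm hkq hβ₁ hβ₂ hμ₁ hμ₂ hββ hβc hb₁ hb₂ hu t ht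
  have hr := hu.regular
  have h0T : (0 : ℝ) ∈ Icc 0 T := ⟨le_rfl, hT.le⟩
  have hsub : Icc 0 t ⊆ Icc 0 T := Icc_subset_Icc_right ht.2
  have hu₁ : FracWave.normSq l (fun x => FracWave.pdt T u x 0) = FracWave.normSq l u₁ :=
    FracWave.normSq_congr hl.le hu.initial_velocity
  have hu₀ : FracWave.sobolevNormSq l (fun x => u x 0) = FracWave.sobolevNormSq l u₀ :=
    congrArg₂ (· + ·) (FracWave.normSq_congr hl.le hu.initial)
      (FracWave.normSq_congr hl.le fun x hx => derivWithin_congr hu.initial (hu.initial x hx))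
  have hsob : ∀ w, 0 ≤ FracWave.sobolevNormSq l w := fun w =>
    add_nonneg (FracWave.normSq_nonneg hl.le _) (FracWave.normSq_nonneg hl.le _)
  have cS := FracWave.continuousOn_sourceSq hl.le hT hf hμ₁ hμ₂
  set I : ℝ := ∫ τ in (0 : ℝ)..t, FracWave.sourceSq l T f μ₁ μ₂ τ with hI
  have hI0 : 0 ≤ I :=
    intervalIntegral.integral_nonneg ht.1 fun τ _ => FracWave.sourceSq_nonneg hl.le τ
  set Z : ℝ := FracWave.supNorm T μ₁ ^ 2 + FracWave.supNorm T μ₂ ^ 2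
    + FracWave.normSq l u₁ + FracWave.sobolevNormSq l u₀ with hZ
  have n1 := FracWave.normSq_nonneg hl.le u₁
  have n0 := hsob u₀
  have hZ0 : 0 ≤ Z := by positivity
  have main := FracWave.energy_gronwall
    (J := FracWave.rlIntegral (1 - α) (fun τ => FracWave.normSq l (fun x => FracWave.pdt T u x τ)))
    (Y := FracWave.traceSobolevSq l u) (a := C * (I + Z)) (κ := κ) (K := K) ht (by positivity) hκ hK
    (fun s hs => FracWave.rlIntegral_nonneg h1α hs.1 fun τ => FracWave.normSq_nonneg hl.le _)
    ((FracWave.continuousOn_traceSobolevSq hl.le hT.le hr).mono hsub)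
    (add_nonneg (hsob _) (by positivity)) (by
      intro s hs
      have hs' := hsub hs
      have e1 := hu.energy_add_kinetic_le hα hl hT hk hq hf hkq hβ₁ hβ₂ hμ₁ hμ₂ hβc hs'
      have e2 := FracWave.le_robinEnergy (μ₁ := μ₁) (μ₂ := μ₂) hl.le hβ hk.contRect hq.contRect hr
        hs' (fun x hx => (hkc x hx s hs').1) (fun x hx => (hqm x hx s hs').1) (hββ s hs')
      have e3 := FracWave.robinEnergy_zero_le (μ₁ := μ₁) (μ₂ := μ₂) hl hT.le hk.contRect
        hq.contRect hr (fun x hx => (hkc x hx 0 h0T).2) (fun x hx => (hqm x hx 0 h0T).2) hb₁ hb₂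
      -- Grönwall's inequality needs a forcing constant independent of `s`, so the source integral
      -- is extended to the final time `t`.
      have e4 : ∫ τ in (0 : ℝ)..s, FracWave.sourceSq l T f μ₁ μ₂ τ ≤ I := by
        refine intervalIntegral.integral_mono_interval le_rfl hs.1 hs.2
          (Filter.Eventually.of_forall fun τ => FracWave.sourceSq_nonneg hl.le τ) ?_
        apply ContinuousOn.intervalIntegrable
        rw [uIcc_of_le ht.1]
        exact cS.mono hsub
      have a1 := FracWave.sq_le_supNorm_sq hμ₁.continuousOn hs'
      have a2 := FracWave.sq_le_supNorm_sq hμ₂.continuousOn hs'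
      have a3 := FracWave.sq_le_supNorm_sq hμ₁.continuousOn h0T
      have a4 := FracWave.sq_le_supNorm_sq hμ₂.continuousOn h0T
      rw [hu₁] at e1
      rw [hu₀] at e3
      have b1 := mul_le_mul_of_nonneg_left e4 (by positivity : 0 ≤ 1 + A)
      have b2 : 1 / β * (μ₁ s ^ 2 + μ₂ s ^ 2) ≤
          1 / β * (FracWave.supNorm T μ₁ ^ 2 + FracWave.supNorm T μ₂ ^ 2) :=
        mul_le_mul_of_nonneg_left (add_le_add a1 a2) (by positivity)
      have z1 : FracWave.normSq l u₁ ≤ Z := by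
        rw [hZ]; linarith [sq_nonneg (FracWave.supNorm T μ₁), sq_nonneg (FracWave.supNorm T μ₂)]
      have z2 : FracWave.sobolevNormSq l u₀ ≤ Z := by
        rw [hZ]; linarith [sq_nonneg (FracWave.supNorm T μ₁), sq_nonneg (FracWave.supNorm T μ₂)]
      have z3 : FracWave.supNorm T μ₁ ^ 2 + FracWave.supNorm T μ₂ ^ 2 ≤ Z := by
        rw [hZ]; linarith
      have y1 := mul_le_mul_of_nonneg_left z1 hB.le
      have y2 := mul_le_mul_of_nonneg_left z2 hE.le
      have y3 := mul_le_mul_of_nonneg_left z3 (by positivity : 0 ≤ 1 + 1 / β)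
      have x1 : 0 ≤ (B + E + (1 + 1 / β)) * I := by positivity
      have x2 : 0 ≤ (1 + A) * Z := by positivity
      have expand : C * (I + Z) = (1 + A) * I + (1 + A) * Z + (B + E + (1 + 1 / β)) * I +
        (B * Z + E * Z + (1 + 1 / β) * Z) := by rw [hCdef]; ring
      rw [expand]
      linarith)
  have drop : FracWave.sobolevNormSq l (fun x => u x t) ≤ FracWave.traceSobolevSq l u t :=
    le_add_of_nonneg_right (by positivity)
  have final : L * C * I + L * C * Z = L * (C * (I + Z)) := by ring
  change _ ≤ L * C * I + L * C * Z
  rw [final]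
  linarith
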